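/- Let $(X_n)_{n\ge 1}$ be independent copies of a real random variable $X$ with $\mathbb E X=0$, $\operatorname{Var}(X)=1$ and $\mathbb E\,e^{b|X|}<\infty$ for some $b>0$. Put $Z_n=(X_1+\dots+X_n)/\sqrt n$, and suppose that $Z_{n_0}$ has a bounded density for some integer $n_0\ge 1$. Let $\varphi(x)=\frac{1}{\sqrt{2\pi}}e^{-x^2/2}$, and let $\gamma_k=\frac{d^k}{dt^k}\log \mathbb E\,e^{tX}\big|_{t=0}$ denote the cumulants of $X$. Suppose that the first nonzero cumulant $\gamma_m$ of order $m\ge 3$ has even order $m\ge 4$ and satisfies $\gamma_m<0$. Then for every $n\ge 2n_0$ the variable $Z_n$ has a bounded continuous density $p_n$ (the continuous density being unique), and there exist constants $\tau_0>0$ and $c>0$, which do not depend on $n$ and $x$, such that for all $n\ge 2n_0$ and all $x\in\mathbb R$ with $|x|/\sqrt n\le\tau_0$, $$\frac{p_n(x)-\varphi(x)}{\varphi(x)}\le \frac{c\,(\log n)^3}{n}.$$ -/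

import Mathlib

open MeasureTheory ProbabilityTheory

noncomputable section

namespace LocalLimit

/-- The `k`-th cumulant of the real random variable `X` under `P`: the `k`-th derivative at `0`
of its log-Laplace transform `t ↦ log E exp (t X)`. -/
def cumulant {Ω : Type*} [MeasurableSpace Ω] (X : Ω → ℝ) (P : Measure Ω) (k : ℕ) : ℝ :=
  iteratedDeriv k (cgf X P) 0

/-- The normalized sum `(ξ₀ + ⋯ + ξₙ₋₁) / √n` of the first `n` terms of a sequence. -/
def normalizedSum {Ω : Type*} (ξ : ℕ → Ω → ℝ) (n : ℕ) (ω : Ω) : ℝ :=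
  (∑ i ∈ Finset.range n, ξ i ω) / √(n : ℝ)

/-- `p` is a probability density, with respect to Lebesgue measure, of the random variable `Y`. -/
structure IsDensity {Ω : Type*} [MeasurableSpace Ω] (p : ℝ → ℝ) (Y : Ω → ℝ)
    (P : Measure Ω) : Prop where
  measurable : Measurable p
  nonneg : ∀ x, 0 ≤ p x
  hasLaw : HasLaw Y (volume.withDensity fun x => ENNReal.ofReal (p x)) P

/-- `p` is bounded from above by a constant. -/
def IsBoundedAbove (p : ℝ → ℝ) : Prop :=
  ∃ M : ℝ, ∀ x, p x ≤ M

end LocalLimit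

end

noncomputable section

namespace LocalLimit

open scoped FourierTransform SchwartzMap
open Filter Topology

/-! ### Fourier transforms on the real line -/

/-! The proof is an exponential tilt at the saddle point, used only for an upper bound. Let `M` be
the Laplace transform of `X` and `K = log M`. Inverting the Fourier transform of the density tilted
by `exp (s √n x)`, with absolute values inside, bounds `p x * exp (s √n x)` by `√n / 2π` times `∫
|M(s + it)|^n dt` (`IsDensity.mul_exp_le_of_integral_bound`). No phase has to be controlled. The law
of `X` tilted by `s` has variance `K''(s)`, so this integral is at most `M(s)^n (√(2π / (n K''(s)))
+ A / n^{3/2})`, uniformly for `s` near `0` (`exists_integral_norm_complexMGF_pow_le`). The tail in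
`t` is handled by Plancherel, which makes `|M(s + it)|^{2 n₀}` integrable, and by a gap below `1`
away from `t = 0`.

For `x = √n K'(s)` the ratio to the Gaussian density becomes at most `exp (-n (s K' - K - K'^2 / 2))
(1 + O(s^{m-2}) + A / n)`. Because `γ_m < 0` and `m` is even, the bracket in the exponent is at
least `c s^m` (`exists_eventually_legendre_ge`). Either the decay `exp (-c n s^m)` beats the
correction `O(s^{m-2})`, or `s^2 = O(1/n)` and the correction is itself `O(1/n)`
(`exp_neg_mul_one_add_le`). The result is a bound `O(1/n)`, stronger than the one claimed. -/

lemma ae_eq_of_forall_schwartz_integral_mul_eq {f g : ℝ → ℂ} (hf : LocallyIntegrable f)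
    (hg : LocallyIntegrable g) (h : ∀ u : 𝓢(ℝ, ℂ), ∫ x, u x * f x = ∫ x, u x * g x) :
    f =ᵐ[volume] g := by
  refine ae_eq_of_integral_contDiff_smul_eq hf hg fun u hu hc => ?_
  have hg₁ : HasCompactSupport (Complex.ofRealCLM ∘ u) := hc.comp_left rfl
  have hg₂ : ContDiff ℝ ((⊤ : ℕ∞) : WithTop ℕ∞) (Complex.ofRealCLM ∘ u) := by fun_prop
  simpa using h (hg₁.toSchwartzMap hg₂)

lemma integral_fourier_mul_eq_of_integrable {f g : ℝ → ℂ} (hf : Integrable f)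
    (hg : Integrable g) : ∫ x, 𝓕 f x * g x = ∫ x, f x * 𝓕 g x := by
  simpa using! VectorFourier.integral_fourierIntegral_smul_eq_flip (L := innerₗ ℝ)
    Real.continuous_fourierChar continuous_inner hf hg

lemma continuous_fourier_of_integrable {f : ℝ → ℂ} (hf : Integrable f) : Continuous (𝓕 f) :=
  VectorFourier.fourierIntegral_continuous Real.continuous_fourierChar (by exact continuous_inner)
    hf

lemma continuous_fourierInv_of_integrable {f : ℝ → ℂ} (hf : Integrable f) :
    Continuous (𝓕⁻ f) := by
  have : 𝓕⁻ f = fun x => 𝓕 f (-x) := funext fun x => Real.fourierInv_eq_fourier_neg f x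
  rw [this]
  exact (continuous_fourier_of_integrable hf).comp continuous_neg

lemma norm_fourierInv_le_integral_norm (f : ℝ → ℂ) (x : ℝ) : ‖𝓕⁻ f x‖ ≤ ∫ y, ‖f y‖ := by
  rw [Real.fourierInv_eq_fourier_neg]
  exact VectorFourier.norm_fourierIntegral_le_integral_norm _ _ _ _ _

/-- Tested against a Schwartz function, both transforms move onto the test function, where inversion
is exact. Continuity of `f` is therefore not needed, at the price of equality almost everywhere. -/
lemma fourierInv_fourier_ae_eq {f : ℝ → ℂ} (hf : Integrable f) (h'f : Integrable (𝓕 f)) :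
    𝓕⁻ (𝓕 f) =ᵐ[volume] f := by
  refine ae_eq_of_forall_schwartz_integral_mul_eq
    (continuous_fourierInv_of_integrable h'f).locallyIntegrable hf.locallyIntegrable fun u => ?_
  have h1 : ∀ x, 𝓕⁻ (𝓕 f) x = 𝓕 (𝓕 f) (-x) := Real.fourierInv_eq_fourier_neg _
  have hu : Integrable (fun x => u (-x)) := u.integrable.comp_neg
  calc ∫ x, u x * 𝓕⁻ (𝓕 f) x = ∫ x, u (-x) * 𝓕 (𝓕 f) x := by
        rw [← integral_neg_eq_self]; simp [h1]
    _ = ∫ x, 𝓕 (fun x => u (-x)) x * 𝓕 f x :=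
        (integral_fourier_mul_eq_of_integrable hu h'f).symm
    _ = ∫ x, 𝓕⁻ u x * 𝓕 f x := by
        have h2 : ∀ x, 𝓕⁻ u x = 𝓕 (fun x => u (-x)) x := fun x => by
          rw [SchwartzMap.fourierInv_coe, Real.fourierInv_eq_fourier_comp_neg]
        simp [h2]
    _ = ∫ x, 𝓕 f x * 𝓕⁻ u x := by simp_rw [mul_comm]
    _ = ∫ x, f x * 𝓕 (𝓕⁻ u : 𝓢(ℝ, ℂ)) x := by
        rw [integral_fourier_mul_eq_of_integrable hf (𝓕⁻ u).integrable, SchwartzMap.fourier_coe]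
    _ = ∫ x, u x * f x := by simp_rw [FourierTransform.fourier_fourierInv_eq, mul_comm]

/-- The `L²` transform and the integral transform induce the same tempered distribution, hence agree
almost everywhere. This makes the `L²` isometry usable for concrete integrals. -/
lemma fourier_toLp_ae_eq {f : ℝ → ℂ} (hf : Integrable f) (hf2 : MemLp f 2) :
    (𝓕 (hf2.toLp f) : Lp ℂ 2 (volume : Measure ℝ)) =ᵐ[volume] 𝓕 f := by
  refine ae_eq_of_forall_schwartz_integral_mul_eq
    ((Lp.memLp _).locallyIntegrable (by norm_num))
    (continuous_fourier_of_integrable hf).locallyIntegrable fun u => ?_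
  have h := congrArg (fun T => T u) (Lp.fourier_toTemperedDistribution_eq (hf2.toLp f))
  simp only [TemperedDistribution.fourier_apply, Lp.toTemperedDistribution_apply,
    smul_eq_mul] at h
  rw [← h]
  calc ∫ x, 𝓕 u x * (hf2.toLp f) x = ∫ x, 𝓕 u x * f x := by
        refine integral_congr_ae ?_
        filter_upwards [hf2.coeFn_toLp] with x hx
        rw [hx]
    _ = ∫ x, u x * 𝓕 f x := by
        rw [SchwartzMap.fourier_coe, integral_fourier_mul_eq_of_integrable u.integrable hf]

/-- Plancherel's identity for functions in `L¹ ∩ L²`. -/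
lemma integral_norm_fourier_sq {f : ℝ → ℂ} (hf : Integrable f) (hf2 : MemLp f 2) :
    Integrable (fun x => ‖𝓕 f x‖ ^ 2) ∧ ∫ x, ‖𝓕 f x‖ ^ 2 = ∫ x, ‖f x‖ ^ 2 := by
  have h1 := fourier_toLp_ae_eq hf hf2
  have hL : MemLp (𝓕 f) 2 := (Lp.memLp _).ae_eq h1
  refine ⟨hL.integrable_norm_pow (by norm_num), ?_⟩
  have h2 := Lp.inner_fourier_eq (hf2.toLp f) (hf2.toLp f)
  rw [L2.inner_def, L2.inner_def] at h2
  have e1 : ∫ x, inner ℂ ((𝓕 (hf2.toLp f) : Lp ℂ 2 (volume : Measure ℝ)) x)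
      ((𝓕 (hf2.toLp f) : Lp ℂ 2 (volume : Measure ℝ)) x) = ((∫ x, ‖𝓕 f x‖ ^ 2 : ℝ) : ℂ) := by
    rw [← integral_complex_ofReal]
    refine integral_congr_ae ?_
    filter_upwards [h1] with x hx
    rw [hx, inner_self_eq_norm_sq_to_K]; simp
  have e2 : ∫ x, inner ℂ ((hf2.toLp f) x) ((hf2.toLp f) x) = ((∫ x, ‖f x‖ ^ 2 : ℝ) : ℂ) := by
    rw [← integral_complex_ofReal]
    refine integral_congr_ae ?_
    filter_upwards [hf2.coeFn_toLp] with x hx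
    rw [hx, inner_self_eq_norm_sq_to_K]; simp
  rw [e1, e2] at h2
  exact_mod_cast h2

/-! ### Random variables with a density -/

section Density

variable {Ω : Type*} [MeasurableSpace Ω] {P : Measure Ω} {Y : Ω → ℝ} {p : ℝ → ℝ}

lemma IsDensity.integral_comp {E : Type*} [NormedAddCommGroup E] [NormedSpace ℝ E]
    (hp : IsDensity p Y P) {g : ℝ → E} (hg : StronglyMeasurable g) :
    ∫ ω, g (Y ω) ∂P = ∫ y, p y • g y := by
  have h := hp.hasLaw.integral_comp (f := g) hg.aestronglyMeasurable
  rw [integral_withDensity_eq_integral_toReal_smul hp.measurable.ennreal_ofReal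
    (by simp)] at h
  simpa [Function.comp_def, ENNReal.toReal_ofReal, hp.nonneg] using h

lemma IsDensity.integrable_comp_iff {E : Type*} [NormedAddCommGroup E] [NormedSpace ℝ E]
    (hp : IsDensity p Y P) {g : ℝ → E} (hg : StronglyMeasurable g) :
    Integrable (fun ω => g (Y ω)) P ↔ Integrable (fun y => p y • g y) := by
  have h := integrable_map_measure (f := Y) (μ := P) hg.aestronglyMeasurable hp.hasLaw.aemeasurable
  rw [hp.hasLaw.map_eq,
    integrable_withDensity_iff_integrable_smul' hp.measurable.ennreal_ofReal (by simp)] at h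
  simpa [Function.comp_def, ENNReal.toReal_ofReal, hp.nonneg] using h.symm

/-- The density `p` multiplied by the exponential `y ↦ exp (a y)`. -/
def expTilt (p : ℝ → ℝ) (a : ℝ) (y : ℝ) : ℂ := ((p y * Real.exp (a * y) : ℝ) : ℂ)

lemma norm_expTilt (hp : IsDensity p Y P) (a y : ℝ) :
    ‖expTilt p a y‖ = p y * Real.exp (a * y) := by
  rw [expTilt, Complex.norm_real, Real.norm_eq_abs,
    abs_of_nonneg (mul_nonneg (hp.nonneg y) (Real.exp_nonneg _))]

lemma IsDensity.integrable_expTilt (hp : IsDensity p Y P) {a : ℝ}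
    (ha : Integrable (fun ω => Real.exp (a * Y ω)) P) : Integrable (expTilt p a) := by
  have h := (hp.integrable_comp_iff (g := fun y => Real.exp (a * y))
    (by fun_prop : Measurable _).stronglyMeasurable).1 ha
  exact h.ofReal

lemma IsDensity.fourier_expTilt (hp : IsDensity p Y P) (a w : ℝ) :
    𝓕 (expTilt p a) w = complexMGF Y P (a + (-2 * Real.pi * w : ℝ) * Complex.I) := by
  rw [complexMGF, hp.integral_comp (g := fun y : ℝ => Complex.exp
    ((a + (-2 * Real.pi * w : ℝ) * Complex.I) * y))
    (by fun_prop : Measurable _).stronglyMeasurable, Real.fourier_real_eq_integral_exp_smul]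
  refine integral_congr_ae (ae_of_all _ fun y => ?_)
  simp only [expTilt, smul_eq_mul, Complex.real_smul]
  push_cast
  rw [mul_comm, mul_assoc, ← Complex.exp_add]
  congr 2
  ring

/-- Pointwise bound of a continuous density through its Laplace transform. -/
lemma IsDensity.mul_exp_le_integral (hp : IsDensity p Y P) (hc : Continuous p) {a : ℝ}
    (ha : Integrable (fun ω => Real.exp (a * Y ω)) P)
    (hint : Integrable fun w : ℝ => complexMGF Y P (a + (-2 * Real.pi * w : ℝ) * Complex.I))
    (x : ℝ) :
    p x * Real.exp (a * x)
      ≤ ∫ w : ℝ, ‖complexMGF Y P (a + (-2 * Real.pi * w : ℝ) * Complex.I)‖ := by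
  have hF : 𝓕 (expTilt p a)
      = fun w : ℝ => complexMGF Y P (a + (-2 * Real.pi * w : ℝ) * Complex.I) :=
    funext fun w => hp.fourier_expTilt a w
  have hcont : Continuous (expTilt p a) := by unfold expTilt; fun_prop
  have hinv := congrFun (hcont.fourierInv_fourier_eq (hp.integrable_expTilt ha)
    (by rw [hF]; exact hint)) x
  rw [← norm_expTilt hp, ← hinv]
  refine (norm_fourierInv_le_integral_norm _ _).trans_eq ?_
  rw [hF]

/-- The Laplace transform of a bounded density is square integrable along vertical lines. -/
lemma IsDensity.integral_norm_complexMGF_sq_le (hp : IsDensity p Y P) {B : ℝ}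
    (hB : ∀ y, p y ≤ B) {a : ℝ}
    (ha : Integrable (fun ω => Real.exp (a * Y ω)) P)
    (ha2 : Integrable (fun ω => Real.exp (2 * a * Y ω)) P) :
    Integrable (fun w : ℝ =>
        ‖complexMGF Y P (a + (-2 * Real.pi * w : ℝ) * Complex.I)‖ ^ 2) ∧
      ∫ w : ℝ, ‖complexMGF Y P (a + (-2 * Real.pi * w : ℝ) * Complex.I)‖ ^ 2
        ≤ B * mgf Y P (2 * a) := by
  have h2 := (hp.integrable_comp_iff (g := fun y => Real.exp (2 * a * y))
    (by fun_prop : Measurable _).stronglyMeasurable).1 ha2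
  -- Boundedness trades one factor `p` for `B`; what is left integrates to the moment generating
  -- function at `2 * a`.
  have hle : ∀ y, ‖expTilt p a y‖ ^ 2 ≤ B * (p y • Real.exp (2 * a * y)) := fun y => by
    have h0 := hp.nonneg y
    have he : Real.exp (2 * a * y) = Real.exp (a * y) ^ 2 := by
      rw [← Real.exp_nat_mul]; congr 1; push_cast; ring
    rw [norm_expTilt hp, he, smul_eq_mul]
    calc (p y * Real.exp (a * y)) ^ 2 = p y * (p y * Real.exp (a * y) ^ 2) := by ring
      _ ≤ B * (p y * Real.exp (a * y) ^ 2) :=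
        mul_le_mul_of_nonneg_right (hB y) (by positivity)
  have hI := hp.integrable_expTilt ha
  have hsq : Integrable (fun y => ‖expTilt p a y‖ ^ 2) :=
    (h2.const_mul B).mono' (hI.aestronglyMeasurable.norm.pow 2)
      (ae_of_all _ fun y => by simpa using hle y)
  have hL2 : MemLp (expTilt p a) 2 := (memLp_two_iff_integrable_sq_norm hI.1).2 hsq
  have hmain := integral_norm_fourier_sq hI hL2
  simp only [hp.fourier_expTilt] at hmain
  refine ⟨hmain.1, hmain.2.trans_le ?_⟩
  calc ∫ y, ‖expTilt p a y‖ ^ 2 ≤ ∫ y, B * (p y • Real.exp (2 * a * y)) :=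
        integral_mono hsq (h2.const_mul B) hle
    _ = B * mgf Y P (2 * a) := by
        rw [integral_const_mul, mgf, hp.integral_comp (g := fun y => Real.exp (2 * a * y))
          (by fun_prop : Measurable _).stronglyMeasurable]

lemma exists_isDensity_of_absolutelyContinuous [IsFiniteMeasure P] (hY : AEMeasurable Y P)
    (hac : P.map Y ≪ volume) : ∃ q : ℝ → ℝ, IsDensity q Y P := by
  refine ⟨fun y => ((P.map Y).rnDeriv volume y).toReal,
    (Measure.measurable_rnDeriv _ _).ennreal_toReal, fun _ => ENNReal.toReal_nonneg, hY, ?_⟩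
  rw [← Measure.withDensity_rnDeriv_eq _ _ hac]
  refine withDensity_congr_ae ?_
  rw [Measure.withDensity_rnDeriv_eq _ _ hac]
  filter_upwards [Measure.rnDeriv_ne_top (P.map Y) volume] with y hy
  rw [ENNReal.ofReal_toReal hy]

lemma IsDensity.congr (hp : IsDensity p Y P) {q : ℝ → ℝ} (hq : Measurable q)
    (hq0 : ∀ x, 0 ≤ q x) (h : p =ᵐ[volume] q) : IsDensity q Y P := by
  refine ⟨hq, hq0, hp.hasLaw.aemeasurable, ?_⟩
  rw [hp.hasLaw.map_eq]
  refine withDensity_congr_ae ?_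
  filter_upwards [h] with y hy
  rw [hy]

/-- A random variable with an absolutely continuous law and an integrable characteristic function
has a bounded continuous density. -/
lemma exists_continuous_isDensity [IsProbabilityMeasure P] (hY : AEMeasurable Y P)
    (hac : P.map Y ≪ volume)
    (hint : Integrable fun w : ℝ => complexMGF Y P ((-2 * Real.pi * w : ℝ) * Complex.I)) :
    ∃ q : ℝ → ℝ, Continuous q ∧ IsBoundedAbove q ∧ IsDensity q Y P := by
  obtain ⟨q, hq⟩ := exists_isDensity_of_absolutelyContinuous hY hac
  have hI : Integrable (expTilt q 0) := hq.integrable_expTilt (by simp)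
  have hF : 𝓕 (expTilt q 0)
      = fun w : ℝ => complexMGF Y P ((-2 * Real.pi * w : ℝ) * Complex.I) :=
    funext fun w => by rw [hq.fourier_expTilt]; simp
  have hFI : Integrable (𝓕 (expTilt q 0)) := by rw [hF]; exact hint
  have hae := fourierInv_fourier_ae_eq hI hFI
  have hcont := continuous_fourierInv_of_integrable hFI
  -- The inverse transform equals the density only almost everywhere, so its real part is clamped at
  -- `0` to be nonnegative at every point.
  set r : ℝ → ℝ := fun x => max (𝓕⁻ (𝓕 (expTilt q 0)) x).re 0 with hr
  have hrc : Continuous r := (Complex.continuous_re.comp hcont).max continuous_const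
  refine ⟨r, hrc, ⟨∫ w, ‖𝓕 (expTilt q 0) w‖, fun x => ?_⟩,
    hq.congr hrc.measurable (fun x => le_max_right _ _) ?_⟩
  · refine max_le ((Complex.re_le_norm _).trans (norm_fourierInv_le_integral_norm _ _)) ?_
    positivity
  · filter_upwards [hae] with x hx
    simp [hr, hx, expTilt, hq.nonneg x]

end Density

/-! ### Sums of independent copies -/

section Sum

variable {Ω Ω' : Type*} [MeasurableSpace Ω] [MeasurableSpace Ω'] {P : Measure Ω}
  {P' : Measure Ω'} {X : Ω → ℝ} {ξ : ℕ → Ω' → ℝ}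

lemma aemeasurable_normalizedSum (hident : ∀ i, IdentDistrib (ξ i) X P' P) (n : ℕ) :
    AEMeasurable (normalizedSum ξ n) P' := by
  unfold normalizedSum
  exact (Finset.aemeasurable_fun_sum _ fun i _ => (hident i).aemeasurable_fst).div_const _

lemma complexMGF_normalizedSum (hindep : iIndepFun ξ P')
    (hident : ∀ i, IdentDistrib (ξ i) X P' P) (n : ℕ) (z : ℂ) :
    complexMGF (normalizedSum ξ n) P' z = complexMGF X P (z / (√(n : ℝ) : ℝ)) ^ n := by
  have hi : iIndepFun (fun i : Fin n => ξ i) P' := hindep.precomp Fin.val_injective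
  have h := hi.integral_fun_prod_comp (𝕜 := ℂ)
    (f := fun _ (x : ℝ) => Complex.exp (z / (√(n : ℝ) : ℝ) * x))
    (fun i => (hident i).aemeasurable_fst)
    (fun i => (by fun_prop : Measurable _).aestronglyMeasurable)
  have h2 : ∀ i, ∫ ω, Complex.exp (z / (√(n : ℝ) : ℝ) * ξ i ω) ∂P'
      = complexMGF X P (z / (√(n : ℝ) : ℝ)) := fun i =>
    complexMGF_congr_identDistrib (hident i) ▸ rfl
  simp only [h2, Finset.prod_const, Finset.card_univ, Fintype.card_fin] at h
  rw [← h, complexMGF]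
  refine integral_congr_ae (ae_of_all _ fun ω => ?_)
  simp only [normalizedSum, ← Complex.exp_sum, Finset.sum_range]
  rw [← Finset.mul_sum]
  push_cast
  congr 1
  ring

lemma integrable_exp_mul_normalizedSum (hindep : iIndepFun ξ P')
    (hident : ∀ i, IdentDistrib (ξ i) X P' P) (n : ℕ) {a : ℝ}
    (ha : Integrable (fun ω => Real.exp (a / √(n : ℝ) * X ω)) P) :
    Integrable (fun ω => Real.exp (a * normalizedSum ξ n ω)) P' := by
  have := hindep.isProbabilityMeasure
  have hi := fun i => ((hident i).comp (u := fun x : ℝ => Real.exp (a / √(n : ℝ) * x))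
    (by fun_prop)).integrable_iff.2 ha
  have hsum : ∀ k : ℕ, Integrable
      (fun ω => Real.exp (a / √(n : ℝ) * (∑ i ∈ Finset.range k, ξ i) ω)) P' := by
    intro k
    induction k with
    | zero => simp
    | succ k ih =>
      rw [Finset.sum_range_succ]
      exact (hindep.indepFun_finsetSum_of_notMem₀ (fun i => (hident i).aemeasurable_fst)
        Finset.notMem_range_self).integrable_exp_mul_add ih (hi k)
  have h := hsum n
  refine h.congr (ae_of_all _ fun ω => ?_)
  simp only [normalizedSum, Finset.sum_apply]
  congr 1
  ring

lemma map_const_mul_absolutelyContinuous {c : ℝ} (hc : c ≠ 0) {μ : Measure ℝ} (h : μ ≪ volume) :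
    μ.map (fun x => c * x) ≪ volume := by
  refine Measure.AbsolutelyContinuous.mk fun s hs h0 => ?_
  rw [Measure.map_apply (by fun_prop) hs]
  refine h ?_
  rw [Real.volume_preimage_mul_left hc, h0, mul_zero]

/-- The first `k` terms are independent of the remaining ones, and convolving an absolutely
continuous law with any law keeps it absolutely continuous. -/
lemma map_normalizedSum_absolutelyContinuous (hindep : iIndepFun ξ P')
    (hident : ∀ i, IdentDistrib (ξ i) X P' P) {k n : ℕ} (hk : 1 ≤ k) (hkn : k ≤ n)
    (h : P'.map (normalizedSum ξ k) ≪ volume) :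
    P'.map (normalizedSum ξ n) ≪ volume := by
  have := hindep.isProbabilityMeasure
  have hm := fun i => (hident i).aemeasurable_fst
  have hk0 : (0 : ℝ) < k := by exact_mod_cast hk
  have hn0 : (0 : ℝ) < n := by exact_mod_cast hk.trans hkn
  have hsum : ∀ s : Finset ℕ, AEMeasurable (∑ i ∈ s, ξ i) P' := fun s =>
    Finset.aemeasurable_sum _ fun i _ => hm i
  have hdisj : Disjoint (Finset.Ico k n) (Finset.range k) := by
    rw [Finset.disjoint_left]; intro i; simp; omega
  have hind : IndepFun (∑ i ∈ Finset.Ico k n, ξ i) (∑ i ∈ Finset.range k, ξ i) P' := by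
    have h0 := (hindep.indepFun_finset₀ _ _ hdisj hm).comp
      (φ := fun v : Finset.Ico k n → ℝ => ∑ i, v i)
      (ψ := fun v : Finset.range k → ℝ => ∑ i, v i) (by fun_prop) (by fun_prop)
    convert h0 using 1
    · ext ω; simp [Finset.sum_attach _ (fun i => ξ i ω)]
    · ext ω; simp [Finset.sum_attach _ (fun i => ξ i ω)]
  have hS : P'.map (∑ i ∈ Finset.range k, ξ i) ≪ volume := by
    have e : (∑ i ∈ Finset.range k, ξ i) = (fun x => √(k : ℝ) * x) ∘ normalizedSum ξ k := by
      ext ω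
      simp only [Finset.sum_apply, Function.comp, normalizedSum]
      field_simp
    rw [e, ← AEMeasurable.map_map_of_aemeasurable (by fun_prop)
      (aemeasurable_normalizedSum hident k)]
    exact map_const_mul_absolutelyContinuous (by positivity) h
  have hT : P'.map ((∑ i ∈ Finset.Ico k n, ξ i) + ∑ i ∈ Finset.range k, ξ i) ≪ volume := by
    rw [hind.map_add_eq_map_conv_map₀ (hsum _) (hsum _)]
    exact Measure.conv_absolutelyContinuous hS
  have e : normalizedSum ξ n = (fun x => (√(n : ℝ))⁻¹ * x) ∘
      ((∑ i ∈ Finset.Ico k n, ξ i) + ∑ i ∈ Finset.range k, ξ i) := by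
    ext ω
    simp only [Finset.sum_apply, Function.comp, normalizedSum, Pi.add_apply]
    rw [← Finset.sum_range_add_sum_Ico _ hkn]
    ring
  rw [e, ← AEMeasurable.map_map_of_aemeasurable (by fun_prop) ((hsum _).add (hsum _))]
  exact map_const_mul_absolutelyContinuous (by positivity) hT

end Sum

/-! ### Bounds for characteristic functions -/

section CharFun

variable {Ω : Type*} [MeasurableSpace Ω] {P : Measure Ω} {X : Ω → ℝ}

lemma integrable_of_abs_le_one [IsFiniteMeasure P] {f : Ω → ℝ} (hf : AEMeasurable f P)
    (h : ∀ ω, |f ω| ≤ 1) : Integrable f P :=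
  (integrable_const (1 : ℝ)).mono' hf.aestronglyMeasurable (ae_of_all _ h)

/-- The free angle serves three purposes: the argument of the characteristic function recovers its
modulus, and `0` and `π / 2` recover its real and imaginary parts. -/
lemma integral_cos_sub [IsProbabilityMeasure P] (hX : AEMeasurable X P) (t θ : ℝ) :
    ∫ ω, Real.cos (t * X ω - θ) ∂P
      = (Complex.exp (-(θ * Complex.I)) * complexMGF X P (t * Complex.I)).re := by
  rw [complexMGF, ← integral_const_mul]
  simp_rw [← Complex.exp_add]
  have hI : Integrable
      (fun ω => Complex.exp (-(θ * Complex.I) + t * Complex.I * X ω)) P := by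
    refine (integrable_const (1 : ℝ)).mono'
      (by fun_prop : AEMeasurable _ P).aestronglyMeasurable (ae_of_all _ fun ω => ?_)
    rw [Complex.norm_exp]; simp
  have h := integral_re hI
  simp only [RCLike.re_to_complex] at h
  rw [← h]
  refine integral_congr_ae (ae_of_all _ fun ω => ?_)
  have e : -(θ * Complex.I) + t * Complex.I * X ω = ((t * X ω - θ : ℝ) : ℂ) * Complex.I := by
    push_cast; ring
  simp only [e, Complex.exp_ofReal_mul_I_re]

/-- The modulus of a characteristic function at `2 t` is controlled by its modulus at `t`. -/
lemma one_sub_norm_complexMGF_two_mul_le [IsProbabilityMeasure P] (hX : AEMeasurable X P)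
    (t : ℝ) :
    1 - ‖complexMGF X P ((2 * t : ℝ) * Complex.I)‖
      ≤ 4 * (1 - ‖complexMGF X P (t * Complex.I)‖) := by
  set z := complexMGF X P (t * Complex.I) with hz
  have h1 : ∫ ω, Real.cos (t * X ω - z.arg) ∂P = ‖z‖ := by
    rw [integral_cos_sub hX, ← hz]
    conv_lhs => rw [← Complex.norm_mul_exp_arg_mul_I z]
    rw [mul_left_comm, ← Complex.exp_add]
    simp
  have h2 : ∫ ω, Real.cos (2 * t * X ω - 2 * z.arg) ∂P
      ≤ ‖complexMGF X P ((2 * t : ℝ) * Complex.I)‖ := by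
    rw [integral_cos_sub hX]
    refine (Complex.re_le_norm _).trans_eq ?_
    rw [norm_mul, Complex.norm_exp]; simp
  have hc : ∀ θ : ℝ, ∀ r : ℝ, Integrable (fun ω => Real.cos (r * X ω - θ)) P := fun θ r =>
    integrable_of_abs_le_one (by fun_prop) fun ω => Real.abs_cos_le_one _
  -- Pointwise, `cos 2u - (4 cos u - 3) = 2 (cos u - 1)^2 ≥ 0`.
  have h3 : ∫ ω, (4 * Real.cos (t * X ω - z.arg) - 3) ∂P
      ≤ ∫ ω, Real.cos (2 * t * X ω - 2 * z.arg) ∂P := by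
    refine integral_mono (((hc _ _).const_mul 4).sub (integrable_const _)) (hc _ _) fun ω => ?_
    have e : 2 * t * X ω - 2 * z.arg = 2 * (t * X ω - z.arg) := by ring
    simp only [e, Real.cos_two_mul]
    nlinarith [sq_nonneg (Real.cos (t * X ω - z.arg) - 1)]
  rw [integral_sub ((hc _ _).const_mul 4) (integrable_const _), integral_const_mul, h1] at h3
  simp at h3
  linarith

lemma one_sub_norm_complexMGF_two_pow_mul_le [IsProbabilityMeasure P] (hX : AEMeasurable X P)
    (t : ℝ) (N : ℕ) :
    1 - ‖complexMGF X P ((2 ^ N * t : ℝ) * Complex.I)‖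
      ≤ 4 ^ N * (1 - ‖complexMGF X P (t * Complex.I)‖) := by
  induction N with
  | zero => simp
  | succ N ih =>
    have h := one_sub_norm_complexMGF_two_mul_le hX (2 ^ N * t)
    have e : 2 * (2 ^ N * t) = 2 ^ (N + 1) * t := by ring
    rw [e] at h
    rw [pow_succ 4]
    linarith

/-- A characteristic function that vanishes at infinity is bounded away from `1` in modulus
outside of every neighbourhood of the origin. -/
lemma exists_norm_complexMGF_le_of_tendsto [IsProbabilityMeasure P] (hX : AEMeasurable X P)
    (h : Tendsto (fun t : ℝ => complexMGF X P (t * Complex.I)) (cocompact ℝ) (𝓝 0))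
    {ε : ℝ} (hε : 0 < ε) :
    ∃ ρ : ℝ, ρ < 1 ∧ ∀ t : ℝ, ε ≤ |t| → ‖complexMGF X P (t * Complex.I)‖ ≤ ρ := by
  have h' : ∀ᶠ t : ℝ in cocompact ℝ, ‖complexMGF X P (t * Complex.I)‖ ≤ 1 / 2 := by
    have := h.norm
    rw [norm_zero] at this
    exact this.eventually_le_const (by norm_num)
  rw [← Metric.cobounded_eq_cocompact, ← comap_norm_atTop, eventually_comap] at h'
  obtain ⟨T, hT⟩ := eventually_atTop.1 h'
  obtain ⟨N, hN⟩ := pow_unbounded_of_one_lt (T / ε) (by norm_num : (1 : ℝ) < 2)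
  -- After `N` doublings every `|t| ≥ ε` lies beyond `T`, where the modulus is at most `1 / 2`; each
  -- doubling costs a factor `4` in the gap below `1`.
  refine ⟨1 - 1 / (2 * 4 ^ N), by simp, fun t ht => ?_⟩
  have h1 : T ≤ ‖2 ^ N * t‖ := by
    rw [norm_mul, norm_pow, Real.norm_ofNat, Real.norm_eq_abs]
    rw [div_lt_iff₀ hε] at hN
    have : (2 : ℝ) ^ N * ε ≤ 2 ^ N * |t| := by gcongr
    linarith
  have h2 := hT _ h1 _ rfl
  have h3 := one_sub_norm_complexMGF_two_pow_mul_le (P := P) hX t N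
  have h4 : (1 : ℝ) / 2 ≤ 4 ^ N * (1 - ‖complexMGF X P (t * Complex.I)‖) := by linarith
  have h5 : 1 / (2 * 4 ^ N) ≤ 1 - ‖complexMGF X P (t * Complex.I)‖ := by
    rw [div_le_iff₀ (by positivity)]
    linarith
  linarith

/-- A quadratic error is enough, since the sine integral enters squared and so contributes at order
`t ^ 4`; it also avoids third moments. -/
lemma abs_sin_sub_self_le (u : ℝ) : |Real.sin u - u| ≤ 2 * u ^ 2 := by
  rcases le_or_gt |u| 1 with h | h
  · have h1 := Real.sin_bound h
    have h2 : |u| ^ 5 ≤ u ^ 2 := by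
      rw [← sq_abs u]; exact pow_le_pow_of_le_one (abs_nonneg u) h (by norm_num)
    have h3 : |u ^ 3| ≤ u ^ 2 := by
      rw [← sq_abs u, abs_pow]; exact pow_le_pow_of_le_one (abs_nonneg u) h (by norm_num)
    have h4 : Real.sin u - u = (Real.sin u - (u - u ^ 3 / 6)) - u ^ 3 / 6 := by ring
    rw [h4]
    refine (abs_sub _ _).trans ?_
    rw [abs_div, abs_of_pos (by norm_num : (0 : ℝ) < 6)]
    linarith [sq_nonneg u]
  · refine (abs_sub _ _).trans ?_
    have := Real.abs_sin_le_one u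
    rw [← sq_abs u]
    nlinarith

/-- The quartic term is generous enough for the bound to hold for all `u`, so it can be integrated
without truncation. -/
lemma cos_le_one_sub_sq_add_pow_four (u : ℝ) : Real.cos u ≤ 1 - u ^ 2 / 2 + u ^ 4 / 2 := by
  have e : u ^ 4 = |u| ^ 4 := by rw [← abs_pow, abs_of_nonneg (by positivity)]
  rcases le_or_gt |u| 1 with h | h
  · have h1 := (abs_le.1 (Real.cos_bound h)).2
    have : 0 ≤ |u| ^ 4 := by positivity
    rw [e]
    linarith
  · have h1 := Real.cos_le_one u
    have h2 : u ^ 2 ≤ u ^ 4 := by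
      rw [e, ← sq_abs u]; exact pow_le_pow_right₀ h.le (by norm_num)
    linarith

/-- Gaussian bound near the origin for the characteristic function of a centered variable. -/
lemma norm_complexMGF_sq_le_exp [IsProbabilityMeasure P] (hX : MemLp X 4 P)
    (hmean : ∫ ω, X ω ∂P = 0) (t : ℝ) :
    ‖complexMGF X P (t * Complex.I)‖ ^ 2
      ≤ Real.exp (-(∫ ω, X ω ^ 2 ∂P) * t ^ 2
          + (∫ ω, X ω ^ 4 ∂P + 5 * (∫ ω, X ω ^ 2 ∂P) ^ 2) * t ^ 4) := by
  have hXm := hX.aestronglyMeasurable.aemeasurable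
  have i1 : Integrable X P := hX.integrable (by norm_num)
  have i2 : Integrable (fun ω => X ω ^ 2) P := (hX.mono_exponent (by norm_num)).integrable_sq
  have i4 : Integrable (fun ω => X ω ^ 4) P := by
    have := hX.integrable_norm_pow (by norm_num)
    refine this.congr (ae_of_all _ fun ω => ?_)
    simp only [Real.norm_eq_abs]
    rw [← abs_pow, abs_of_nonneg (by positivity)]
  set v := ∫ ω, X ω ^ 2 ∂P with hv
  set k := ∫ ω, X ω ^ 4 ∂P with hk
  set A := ∫ ω, Real.cos (t * X ω) ∂P with hA
  set S := ∫ ω, Real.sin (t * X ω) ∂P with hS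
  have ic : Integrable (fun ω => Real.cos (t * X ω)) P :=
    integrable_of_abs_le_one (by fun_prop) fun ω => Real.abs_cos_le_one _
  have is : Integrable (fun ω => Real.sin (t * X ω)) P :=
    integrable_of_abs_le_one (by fun_prop) fun ω => Real.abs_sin_le_one _
  have hre : (complexMGF X P (t * Complex.I)).re = A := by
    have := integral_cos_sub (P := P) hXm t 0
    simpa using this.symm
  have him : (complexMGF X P (t * Complex.I)).im = S := by
    have := integral_cos_sub (P := P) hXm t (Real.pi / 2)
    simp only [Real.cos_sub_pi_div_two] at this
    rw [← hS] at this
    rw [this]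
    have e : Complex.exp (-((Real.pi / 2 : ℝ) * Complex.I)) = -Complex.I := by
      rw [Complex.exp_neg]; push_cast; rw [Complex.exp_pi_div_two_mul_I, Complex.inv_I]
    rw [e]; simp
  have hA1 : A ≤ 1 - v * t ^ 2 / 2 + k * t ^ 4 / 2 := by
    have := integral_mono (μ := P) ic
      (((integrable_const (1 : ℝ)).sub (i2.const_mul (t ^ 2 / 2))).add (i4.const_mul (t ^ 4 / 2)))
      (fun ω => by
        have := cos_le_one_sub_sq_add_pow_four (t * X ω)
        simp only [Pi.add_apply, Pi.sub_apply]
        calc _ ≤ _ := this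
          _ = _ := by ring)
    rw [integral_add' ((integrable_const _).sub (i2.const_mul _)) (i4.const_mul _),
      integral_sub' (integrable_const _) (i2.const_mul _), integral_const_mul,
      integral_const_mul] at this
    simp at this
    linarith
  have hA2 : 1 - v * t ^ 2 / 2 ≤ A := by
    have := integral_mono (μ := P) ((integrable_const (1 : ℝ)).sub (i2.const_mul (t ^ 2 / 2))) ic
      (fun ω => by
        have := Real.one_sub_sq_div_two_le_cos (x := t * X ω)
        simp only [Pi.sub_apply]
        calc _ = _ := by ring
          _ ≤ _ := this)
    rw [integral_sub' (integrable_const _) (i2.const_mul _), integral_const_mul] at this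
    simp at this
    linarith
  have hA3 : A ≤ 1 := by
    have := integral_mono (μ := P) ic (integrable_const (1 : ℝ)) fun ω => Real.cos_le_one _
    simpa using this
  have hSle : |S| ≤ 2 * v * t ^ 2 := by
    -- Centering allows the linear term to be subtracted for free.
    have e : S = ∫ ω, (Real.sin (t * X ω) - t * X ω) ∂P := by
      rw [integral_sub is (i1.const_mul t), integral_const_mul, hmean]; simp [hS]
    rw [e]
    refine (abs_integral_le_integral_abs).trans ?_
    have := integral_mono (μ := P) (is.sub (i1.const_mul t)).abs (i2.const_mul (2 * t ^ 2))
      (fun ω => by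
        have := abs_sin_sub_self_le (t * X ω)
        calc _ ≤ _ := this
          _ = _ := by ring)
    rw [integral_const_mul] at this
    refine this.trans_eq ?_
    ring
  have hS2 : S ^ 2 ≤ 4 * v ^ 2 * t ^ 4 := by
    calc S ^ 2 = |S| ^ 2 := (sq_abs S).symm
      _ ≤ (2 * v * t ^ 2) ^ 2 := by gcongr
      _ = _ := by ring
  -- From `A^2 = 2A - 1 + (1 - A)^2`: the upper bound on `A` controls the linear part, the lower
  -- bound the square.
  have hAA : A ^ 2 ≤ 1 - v * t ^ 2 + k * t ^ 4 + v ^ 2 * t ^ 4 := by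
    have h1 : (1 - A) ^ 2 ≤ (v * t ^ 2 / 2) ^ 2 := by
      have : 0 ≤ 1 - A := by linarith
      gcongr
      linarith
    have h2 : 0 ≤ v ^ 2 * t ^ 4 := by positivity
    nlinarith
  rw [← Complex.normSq_eq_norm_sq, Complex.normSq_apply, hre, him]
  have hfin := Real.add_one_le_exp (-v * t ^ 2 + (k + 5 * v ^ 2) * t ^ 4)
  nlinarith

end CharFun

/-! ### Characteristic functions of exponentially tilted laws -/

section Tilted

variable {Ω : Type*} [MeasurableSpace Ω] {P : Measure Ω} {X : Ω → ℝ}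

lemma zero_mem_interior_integrableExpSet (hX : AEMeasurable X P) {b : ℝ} (hb : 0 < b)
    (h : Integrable (fun ω => Real.exp (b * |X ω|)) P) :
    0 ∈ interior (integrableExpSet X P) := by
  refine mem_interior.2 ⟨Set.Ioo (-b) b, fun t ht => ?_, isOpen_Ioo, by simpa using hb⟩
  refine h.mono' (by fun_prop : AEMeasurable _ P).aestronglyMeasurable (ae_of_all _ fun ω => ?_)
  rw [Real.norm_eq_abs, Real.abs_exp, Real.exp_le_exp]
  refine (le_abs_self _).trans ?_
  rw [abs_mul]
  gcongr
  exact (abs_lt.2 ht).le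

lemma eventually_mem_interior_integrableExpSet (h0 : 0 ∈ interior (integrableExpSet X P)) :
    ∀ᶠ s in 𝓝 (0 : ℝ), s ∈ interior (integrableExpSet X P) :=
  isOpen_interior.mem_nhds h0

lemma one_le_mgf [IsProbabilityMeasure P] (hX : Integrable X P) (hmean : ∫ ω, X ω ∂P = 0) {s : ℝ}
    (hs : Integrable (fun ω => Real.exp (s * X ω)) P) : 1 ≤ mgf X P s := by
  have h := integral_mono (μ := P) ((hX.const_mul s).add (integrable_const 1)) hs
    fun ω => Real.add_one_le_exp (s * X ω)
  rw [integral_add' (hX.const_mul s) (integrable_const 1), integral_const_mul, hmean] at h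
  simpa [mgf] using h

/-- The difference is at most `E |exp (s X) - 1|`, which does not involve `t`. By `|a - 1| ≤ δ/2 +
(a - 1)^2 / (2δ)` it suffices that `E (exp (s X) - 1)^2 = M(2s) - 2 M(s) + 1` tends to `0`. -/
lemma eventually_norm_complexMGF_sub_le [IsProbabilityMeasure P] (hX : AEMeasurable X P)
    (h0 : 0 ∈ interior (integrableExpSet X P)) {δ : ℝ} (hδ : 0 < δ) :
    ∀ᶠ s : ℝ in 𝓝 0, ∀ t : ℝ,
      ‖complexMGF X P (s + t * Complex.I) - complexMGF X P (t * Complex.I)‖ ≤ δ := by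
  have hcont : Tendsto (fun s => mgf X P (2 * s) - 2 * mgf X P s + 1) (𝓝 0) (𝓝 0) := by
    have h1 : ContinuousAt (mgf X P) 0 := (analyticAt_mgf h0).continuousAt
    have h2 : Tendsto (fun s : ℝ => 2 * s) (𝓝 0) (𝓝 0) := by
      simpa using (continuous_const_mul (2 : ℝ)).tendsto 0
    have h3 := ((h1.tendsto.comp h2).sub (h1.tendsto.const_mul 2)).add_const 1
    simpa [show (1 : ℝ) - 2 + 1 = 0 by norm_num] using h3
  have htwo : ∀ᶠ s in 𝓝 (0 : ℝ), 2 * s ∈ interior (integrableExpSet X P) := by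
    have h2 : Tendsto (fun s : ℝ => 2 * s) (𝓝 0) (𝓝 0) := by
      simpa using (continuous_const_mul (2 : ℝ)).tendsto 0
    exact h2.eventually (eventually_mem_interior_integrableExpSet h0)
  filter_upwards [hcont.eventually_lt_const (sq_pos_of_pos hδ), htwo,
    eventually_mem_interior_integrableExpSet h0] with s hs hs2 hs1 t
  have i1 : Integrable (fun ω => Real.exp (s * X ω)) P :=
    integrable_of_mem_integrableExpSet (interior_subset hs1)
  have i2 : Integrable (fun ω => Real.exp (2 * s * X ω)) P :=
    integrable_of_mem_integrableExpSet (interior_subset hs2)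
  have c1 : Integrable (fun ω => Complex.exp ((s + t * Complex.I) * X ω)) P :=
    i1.mono' (by fun_prop : AEMeasurable _ P).aestronglyMeasurable
      (ae_of_all _ fun ω => by rw [Complex.norm_exp]; simp)
  have c2 : Integrable (fun ω => Complex.exp (t * Complex.I * X ω)) P :=
    (integrable_const (1 : ℝ)).mono' (by fun_prop : AEMeasurable _ P).aestronglyMeasurable
      (ae_of_all _ fun ω => by rw [Complex.norm_exp]; simp)
  rw [complexMGF, complexMGF, ← integral_sub c1 c2]
  have i4 : Integrable (fun ω => Real.exp (2 * s * X ω) - 2 * Real.exp (s * X ω)) P :=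
    i2.sub (i1.const_mul 2)
  have i3 : Integrable (fun ω => Real.exp (2 * s * X ω) - 2 * Real.exp (s * X ω) + 1) P :=
    i4.add (integrable_const 1)
  have hR : Integrable (fun ω => δ / 2 + (1 / (2 * δ)) *
      (Real.exp (2 * s * X ω) - 2 * Real.exp (s * X ω) + 1)) P :=
    (integrable_const _).add (i3.const_mul _)
  refine (norm_integral_le_of_norm_le hR (ae_of_all _ fun ω => ?_)).trans ?_
  · have e : Complex.exp ((s + t * Complex.I) * X ω) - Complex.exp (t * Complex.I * X ω)
        = Complex.exp ((t * X ω : ℝ) * Complex.I) * ((Real.exp (s * X ω) - 1 : ℝ) : ℂ) := by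
      push_cast
      rw [mul_sub, ← Complex.exp_add, mul_one]
      congr 2 <;> ring
    rw [e, norm_mul, Complex.norm_exp_ofReal_mul_I, one_mul, Complex.norm_real, Real.norm_eq_abs]
    have e2 : Real.exp (2 * s * X ω) = Real.exp (s * X ω) ^ 2 := by
      rw [← Real.exp_nat_mul]; congr 1; push_cast; ring
    rw [e2]
    set a := Real.exp (s * X ω)
    have : δ / 2 + 1 / (2 * δ) * (a ^ 2 - 2 * a + 1) - |a - 1| = (|a - 1| - δ) ^ 2 / (2 * δ) := by
      have : a ^ 2 - 2 * a + 1 = |a - 1| ^ 2 := by rw [sq_abs]; ring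
      rw [this]; field_simp; ring
    have h5 : 0 ≤ (|a - 1| - δ) ^ 2 / (2 * δ) := by positivity
    linarith
  · rw [integral_add (integrable_const _) (i3.const_mul _), integral_const_mul,
      integral_add i4 (integrable_const 1),
      integral_sub i2 (i1.const_mul 2), integral_const_mul]
    have e3 : ∫ ω, Real.exp (2 * s * X ω) ∂P = mgf X P (2 * s) := rfl
    have e4 : ∫ ω, Real.exp (s * X ω) ∂P = mgf X P s := rfl
    rw [e3, e4]
    simp only [integral_const, probReal_univ, smul_eq_mul, one_mul]
    have : 1 / (2 * δ) * (mgf X P (2 * s) - 2 * mgf X P s + 1) ≤ 1 / (2 * δ) * δ ^ 2 := by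
      gcongr
    have e5 : 1 / (2 * δ) * δ ^ 2 = δ / 2 := by field_simp
    linarith

lemma complexMGF_tilted_mul_I (s t : ℝ) :
    complexMGF X (P.tilted (s * X ·)) (t * Complex.I)
      = complexMGF X P (s + t * Complex.I) / mgf X P s := by
  rw [complexMGF, integral_tilted_mul_eq_mgf, complexMGF, ← integral_div]
  refine integral_congr_ae (ae_of_all _ fun ω => ?_)
  simp only [Complex.real_smul]
  push_cast
  rw [add_mul, Complex.exp_add]
  ring

/-- Uniform Gaussian bound near the origin for the characteristic functions of the tilted laws. -/
lemma exists_eventually_norm_complexMGF_le_exp [IsProbabilityMeasure P]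
    (h0 : 0 ∈ interior (integrableExpSet X P)) :
    ∃ C : ℝ, 0 < C ∧ ∀ᶠ s : ℝ in 𝓝 0, ∀ t : ℝ,
      ‖complexMGF X P (s + t * Complex.I)‖ ≤ mgf X P s *
        Real.exp (-(iteratedDeriv 2 (cgf X P) s) * t ^ 2 / 2 + C * t ^ 4) := by
  have hcgf := analyticAt_cgf h0
  have c1 : ContinuousAt (deriv (cgf X P)) 0 := hcgf.deriv.continuousAt
  have c2 : ContinuousAt (iteratedDeriv 2 (cgf X P)) 0 := by
    rw [iteratedDeriv_succ, iteratedDeriv_one]; exact hcgf.deriv.deriv.continuousAt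
  have c4 : ContinuousAt (fun s => iteratedDeriv 4 (mgf X P) s / mgf X P s) 0 :=
    (analyticAt_iteratedDeriv_mgf h0 4).continuousAt.div (analyticAt_mgf h0).continuousAt
      (by simp)
  set B1 := deriv (cgf X P) 0 ^ 4 + 1
  set B2 := iteratedDeriv 2 (cgf X P) 0 ^ 2 + 1
  set B4 := iteratedDeriv 4 (mgf X P) 0 / mgf X P 0 + 1
  have e1 := (c1.pow 4).tendsto.eventually_lt_const (lt_add_one (deriv (cgf X P) 0 ^ 4))
  have e2 := (c2.pow 2).tendsto.eventually_lt_const (lt_add_one (iteratedDeriv 2 (cgf X P) 0 ^ 2))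
  have e4 := c4.tendsto.eventually_lt_const
    (lt_add_one (iteratedDeriv 4 (mgf X P) 0 / mgf X P 0))
  -- The quartic coefficient is `E (X - μ)^4 + 5 Var^2` under the tilted law, with `(x - μ)^4 ≤ 8
  -- x^4 + 8 μ^4`. It is halved because the bound being used is for the squared modulus.
  refine ⟨|8 * (B4 + B1) + 5 * B2| / 2 + 1, by positivity, ?_⟩
  filter_upwards [e1, e2, e4, eventually_mem_interior_integrableExpSet h0]
    with s hs1 hs2 hs4 hs t
  -- Under `Q` the mean is `K'(s)`, the variance is `K''(s)` and the characteristic function is `M(s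
  -- + it) / M(s)`, so the bound for centered variables applies to `X - μ`.
  set Q := P.tilted (s * X ·) with hQ
  replace hs1 : deriv (cgf X P) s ^ 4 ≤ B1 := hs1.le
  replace hs2 : iteratedDeriv 2 (cgf X P) s ^ 2 ≤ B2 := hs2.le
  replace hs4 : iteratedDeriv 4 (mgf X P) s / mgf X P s ≤ B4 := hs4.le
  have hi : Integrable (fun ω => Real.exp (s * X ω)) P :=
    integrable_of_mem_integrableExpSet (interior_subset hs)
  have : IsProbabilityMeasure Q := isProbabilityMeasure_tilted hi
  have hMpos : 0 < mgf X P s := mgf_pos hi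
  set μ := deriv (cgf X P) s with hμ
  have hL : MemLp X 4 Q := memLp_tilted_mul hs 4
  have hmean : Q[X] = μ := integral_tilted_mul_self hs
  have hvar : variance X Q = iteratedDeriv 2 (cgf X P) s := variance_tilted_mul hs
  have hL' : MemLp (fun ω => X ω - μ) 4 Q := hL.sub (memLp_const μ)
  have hmean' : ∫ ω, (X ω - μ) ∂Q = 0 := by
    rw [integral_sub (hL.integrable (by norm_num)) (integrable_const _), hmean]; simp
  have hvar' : ∫ ω, (X ω - μ) ^ 2 ∂Q = iteratedDeriv 2 (cgf X P) s := by
    rw [← hvar, variance_eq_integral hL.aestronglyMeasurable.aemeasurable, hmean]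
  have i4 : ∀ {Z : Ω → ℝ}, MemLp Z 4 Q → Integrable (fun ω => Z ω ^ 4) Q := fun {Z} hZ => by
    have := hZ.integrable_norm_pow (by norm_num)
    refine this.congr (ae_of_all _ fun ω => ?_)
    simp only [Real.norm_eq_abs]
    rw [← abs_pow, abs_of_nonneg (by positivity)]
  have hfour : ∫ ω, X ω ^ 4 ∂Q = iteratedDeriv 4 (mgf X P) s / mgf X P s := by
    rw [integral_tilted_mul_eq_mgf, iteratedDeriv_mgf hs, ← integral_div]
    refine integral_congr_ae (ae_of_all _ fun ω => ?_)
    simp only [smul_eq_mul]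
    ring
  have hfour' : ∫ ω, (X ω - μ) ^ 4 ∂Q ≤ 8 * (B4 + B1) := by
    have h1 : ∫ ω, (X ω - μ) ^ 4 ∂Q ≤ ∫ ω, (8 * X ω ^ 4 + 8 * μ ^ 4) ∂Q := by
      refine integral_mono (i4 hL') (((i4 hL).const_mul 8).add (integrable_const _)) fun ω => ?_
      simp only
      nlinarith [sq_nonneg (X ω + μ), sq_nonneg (X ω ^ 2 - μ ^ 2), sq_nonneg ((X ω + μ) ^ 2),
        sq_nonneg ((X ω - μ) * (X ω + μ)), sq_nonneg (X ω - μ)]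
    rw [integral_add ((i4 hL).const_mul 8) (integrable_const _), integral_const_mul, hfour] at h1
    simp only [integral_const, probReal_univ, smul_eq_mul, one_mul] at h1
    linarith
  have hmain := norm_complexMGF_sq_le_exp hL' hmean' t
  rw [hvar'] at hmain
  have hshift : ‖complexMGF (fun ω => X ω - μ) Q (t * Complex.I)‖
      = ‖complexMGF X P (s + t * Complex.I)‖ / mgf X P s := by
    have : complexMGF (fun ω => X ω - μ) Q (t * Complex.I)
        = Complex.exp ((-(t * μ) : ℝ) * Complex.I) * complexMGF X Q (t * Complex.I) := by
      rw [complexMGF, complexMGF, ← integral_const_mul]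
      refine integral_congr_ae (ae_of_all _ fun ω => ?_)
      simp only [← Complex.exp_add]
      congr 1
      push_cast
      ring
    rw [this, norm_mul, Complex.norm_exp_ofReal_mul_I, one_mul, complexMGF_tilted_mul_I, norm_div,
      Complex.norm_real, Real.norm_eq_abs, abs_of_pos hMpos]
  rw [hshift] at hmain
  rw [← div_le_iff₀' hMpos]
  refine (sq_le_sq₀ (by positivity) (Real.exp_nonneg _)).1 (hmain.trans ?_)
  rw [← Real.exp_nat_mul, Real.exp_le_exp]
  have hle : ∫ ω, (X ω - μ) ^ 4 ∂Q + 5 * iteratedDeriv 2 (cgf X P) s ^ 2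
      ≤ 2 * (|8 * (B4 + B1) + 5 * B2| / 2 + 1) := by
    have := le_abs_self (8 * (B4 + B1) + 5 * B2)
    linarith
  have h4 : 0 ≤ t ^ 4 := by positivity
  have := mul_le_mul_of_nonneg_right hle h4
  push_cast
  linarith

end Tilted

/-! ### Integrals of powers of characteristic functions -/

/-- With `w = n t^2`, the quartic term is `u = C w^2 / n ≤ w / 8`, and `exp u ≤ 1 + u exp u`
isolates an excess carrying the factor `1 / n`. The main term keeps the exact variance `v`, as the
leading constant must not be lost. -/
lemma pow_le_gaussian_add {r v C t ε : ℝ} (hr0 : 0 ≤ r) (hC : 0 < C) (hε : C * ε ^ 2 ≤ 1 / 8)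
    (hv : 1 / 2 ≤ v) (ht : |t| < ε) (hr : r ≤ Real.exp (-v * t ^ 2 / 2 + C * t ^ 4)) {n : ℕ}
    (hn : 1 ≤ n) :
    r ^ n ≤ Real.exp (-(n * v / 2) * t ^ 2)
      + 512 * C / n * Real.exp (-((n : ℝ) / 16) * t ^ 2) := by
  have hn0 : (0 : ℝ) < n := by exact_mod_cast hn
  set w : ℝ := n * t ^ 2 with hw
  have hw0 : 0 ≤ w := by positivity
  set u : ℝ := n * (C * t ^ 4) with hu
  have hu0 : 0 ≤ u := by positivity
  have ht2 : t ^ 2 ≤ ε ^ 2 := by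
    rw [← sq_abs t]; gcongr
  have huw : u ≤ w / 8 := by
    have h1 : C * t ^ 2 ≤ 1 / 8 := (by gcongr : C * t ^ 2 ≤ C * ε ^ 2).trans hε
    calc u = w * (C * t ^ 2) := by rw [hu, hw]; ring
      _ ≤ w * (1 / 8) := by gcongr
      _ = w / 8 := by ring
  have huC : u = C / n * w ^ 2 := by rw [hu, hw]; field_simp
  have h1 : r ^ n ≤ Real.exp (-(n * v / 2) * t ^ 2) * Real.exp u := by
    refine (pow_le_pow_left₀ hr0 hr n).trans_eq ?_
    rw [← Real.exp_nat_mul, ← Real.exp_add]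
    congr 1
    rw [hu]; ring
  have h2 : Real.exp u ≤ 1 + u * Real.exp u := by
    have := Real.add_one_le_exp (-u)
    have h3 : (-u + 1) * Real.exp u ≤ Real.exp (-u) * Real.exp u := by gcongr
    rw [← Real.exp_add, neg_add_cancel, Real.exp_zero] at h3
    linarith
  have h4 : Real.exp (-(n * v / 2) * t ^ 2) * Real.exp u ≤ Real.exp (-(w / 8)) := by
    rw [← Real.exp_add, Real.exp_le_exp]
    have : w / 4 ≤ n * v / 2 * t ^ 2 := by
      calc w / 4 = n * (1 / 2) / 2 * t ^ 2 := by rw [hw]; ring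
        _ ≤ _ := by gcongr
    linarith
  -- Half of the decay absorbs `w ^ 2`: `(w / 16)^2 / 2 ≤ exp (w / 16)` gives the `512` and leaves
  -- `exp (-w / 16)`.
  have h5 : u * Real.exp (-(w / 8)) ≤ 512 * C / n * Real.exp (-((n : ℝ) / 16) * t ^ 2) := by
    have h6 := Real.quadratic_le_exp_of_nonneg (by positivity : 0 ≤ w / 16)
    have h7 : w ^ 2 ≤ 512 * Real.exp (w / 16) := by
      have : 0 ≤ w / 16 := by positivity
      linarith [show (w / 16) ^ 2 / 2 = w ^ 2 / 512 by ring]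
    calc u * Real.exp (-(w / 8)) = C / n * w ^ 2 * Real.exp (-(w / 8)) := by rw [huC]
      _ ≤ C / n * (512 * Real.exp (w / 16)) * Real.exp (-(w / 8)) := by gcongr
      _ = 512 * C / n * (Real.exp (w / 16) * Real.exp (-(w / 8))) := by ring
      _ = _ := by
        rw [← Real.exp_add]
        congr 2
        rw [hw]; ring
  calc r ^ n ≤ Real.exp (-(n * v / 2) * t ^ 2) * Real.exp u := h1
    _ ≤ Real.exp (-(n * v / 2) * t ^ 2) * (1 + u * Real.exp u) := by gcongr
    _ = Real.exp (-(n * v / 2) * t ^ 2)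
        + u * (Real.exp (-(n * v / 2) * t ^ 2) * Real.exp u) := by ring
    _ ≤ Real.exp (-(n * v / 2) * t ^ 2) + u * Real.exp (-(w / 8)) := by gcongr
    _ ≤ _ := by gcongr

/-- Near `0` the Gaussian bound is integrated; outside, `n - k` factors are bounded by `ρ` and the
other `k` keep the integral finite. -/
lemma integral_pow_le_of_gaussian_bound {r : ℝ → ℝ} (hr0 : ∀ t, 0 ≤ r t) (hrc : Continuous r)
    {C ε v ρ L : ℝ} {k : ℕ} (hC : 0 < C) (hε : C * ε ^ 2 ≤ 1 / 8) (hv : 1 / 2 ≤ v)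
    (hsmall : ∀ t, |t| < ε → r t ≤ Real.exp (-v * t ^ 2 / 2 + C * t ^ 4))
    (hρ : 0 < ρ) (hlarge : ∀ t, ε ≤ |t| → r t ≤ ρ)
    (hk : Integrable fun t => r t ^ k) (hkL : ∫ t, r t ^ k ≤ L) {n : ℕ} (hn : 1 ≤ n)
    (hkn : k ≤ n) :
    Integrable (fun t => r t ^ n) ∧
      ∫ t, r t ^ n ≤ √(2 * Real.pi / (n * v)) + 512 * C / n * √(16 * Real.pi / n)
        + ρ ^ (n - k) * L := by
  have hn0 : (0 : ℝ) < n := by exact_mod_cast hn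
  have hv0 : 0 < v := by linarith
  have hb1 : 0 < n * v / 2 := by positivity
  have hb2 : 0 < (n : ℝ) / 16 := by positivity
  have i1 := integrable_exp_neg_mul_sq hb1
  have i2 := (integrable_exp_neg_mul_sq hb2).const_mul (512 * C / n)
  have i3 := hk.const_mul (ρ ^ (n - k))
  have hpt : ∀ t, r t ^ n ≤ Real.exp (-(n * v / 2) * t ^ 2)
      + 512 * C / n * Real.exp (-((n : ℝ) / 16) * t ^ 2) + ρ ^ (n - k) * r t ^ k := fun t => by
    rcases lt_or_ge |t| ε with h | h
    · refine (pow_le_gaussian_add (hr0 t) hC hε hv h (hsmall t h) hn).trans ?_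
      have := pow_nonneg (hr0 t) k
      exact le_add_of_nonneg_right (by positivity)
    · calc r t ^ n = r t ^ (n - k) * r t ^ k := by rw [← pow_add, Nat.sub_add_cancel hkn]
        _ ≤ ρ ^ (n - k) * r t ^ k :=
          mul_le_mul_of_nonneg_right (pow_le_pow_left₀ (hr0 t) (hlarge t h) _)
            (pow_nonneg (hr0 t) k)
        _ ≤ _ := le_add_of_nonneg_left (by positivity)
  have hI : Integrable (fun t => r t ^ n) :=
    ((i1.add i2).add i3).mono' (hrc.pow n).aestronglyMeasurable (ae_of_all _ fun t => by
      rw [Real.norm_eq_abs, abs_of_nonneg (pow_nonneg (hr0 t) n)]; exact hpt t)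
  refine ⟨hI, (integral_mono hI ((i1.add i2).add i3) hpt).trans ?_⟩
  rw [integral_add' (i1.add i2) i3, integral_add' i1 i2, integral_const_mul, integral_const_mul,
    integral_gaussian, integral_gaussian]
  have e1 : Real.pi / (n * v / 2) = 2 * Real.pi / (n * v) := by field_simp
  have e2 : Real.pi / ((n : ℝ) / 16) = 16 * Real.pi / n := by field_simp
  rw [e1, e2]
  gcongr

section

variable {Ω : Type*} [MeasurableSpace Ω] {P : Measure Ω} {X : Ω → ℝ}

lemma continuous_complexMGF_vertical {s : ℝ} (hs : s ∈ interior (integrableExpSet X P)) :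
    Continuous fun t : ℝ => complexMGF X P (s + t * Complex.I) := by
  rw [continuous_iff_continuousAt]
  intro t
  have h : ContinuousAt (complexMGF X P) (s + t * Complex.I) :=
    (analyticAt_complexMGF (by simpa using hs)).continuousAt
  exact ContinuousAt.comp (f := fun t : ℝ => (s + t * Complex.I : ℂ)) h
    (by fun_prop)

lemma exists_integral_norm_complexMGF_pow_le [IsProbabilityMeasure P] (hX : AEMeasurable X P)
    (h0 : 0 ∈ interior (integrableExpSet X P)) (hint : Integrable X P)
    (hmean : ∫ ω, X ω ∂P = 0) (hvar : iteratedDeriv 2 (cgf X P) 0 = 1)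
    (hdecay : Tendsto (fun t : ℝ => complexMGF X P (t * Complex.I)) (cocompact ℝ) (𝓝 0))
    {k : ℕ} (hk : 1 ≤ k) {L : ℝ}
    (hL : ∀ᶠ s : ℝ in 𝓝 0, Integrable (fun t : ℝ => ‖complexMGF X P (s + t * Complex.I)‖ ^ k) ∧
      ∫ t : ℝ, ‖complexMGF X P (s + t * Complex.I)‖ ^ k ≤ L) :
    ∃ A : ℝ, 0 < A ∧ ∀ᶠ s : ℝ in 𝓝 0, ∀ n : ℕ, k ≤ n →
      Integrable (fun t : ℝ => ‖complexMGF X P (s + t * Complex.I)‖ ^ n) ∧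
      ∫ t : ℝ, ‖complexMGF X P (s + t * Complex.I)‖ ^ n
        ≤ mgf X P s ^ n * (√(2 * Real.pi / (n * iteratedDeriv 2 (cgf X P) s))
          + A / (n * √(n : ℝ))) := by
  obtain ⟨C, hC, hCs⟩ := exists_eventually_norm_complexMGF_le_exp h0
  obtain ⟨ε, hε0, hε⟩ : ∃ ε : ℝ, 0 < ε ∧ C * ε ^ 2 ≤ 1 / 8 := by
    refine ⟨√(1 / (8 * C)), by positivity, ?_⟩
    rw [Real.sq_sqrt (by positivity)]
    field_simp
    norm_num
  obtain ⟨ρ₀, hρ₀, hρ₀t⟩ := exists_norm_complexMGF_le_of_tendsto hX hdecay hε0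
  -- The midpoint leaves room `(1 - ρ₀) / 2` for passing from the imaginary axis to the line through
  -- `s`; the `1 / 2` ensures positivity, since `ρ ^ k` is divided by.
  set ρ := max ((1 + ρ₀) / 2) (1 / 2) with hρ
  have hρpos : 0 < ρ := lt_of_lt_of_le (by norm_num) (le_max_right _ _)
  have hρ1 : ρ < 1 := max_lt (by linarith) (by norm_num)
  -- As `n √n ≤ n^2`, this puts the geometric tail below a multiple of `1 / (n √n)`.
  obtain ⟨D, hD⟩ : ∃ D : ℝ, ∀ n : ℕ, (n : ℝ) ^ 2 * ρ ^ n ≤ D := by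
    have := (tendsto_pow_const_mul_const_pow_of_abs_lt_one 2
      (by rwa [abs_of_pos hρpos] : |ρ| < 1)).bddAbove_range
    obtain ⟨D, hD⟩ := this
    exact ⟨D, fun n => hD ⟨n, rfl⟩⟩
  have hD0 : 0 ≤ D := le_trans (by positivity) (hD 0)
  have hL0 : 0 ≤ L := by
    obtain ⟨s, hs⟩ := hL.exists
    exact le_trans (by positivity) hs.2
  refine ⟨512 * C * √(16 * Real.pi) + D / ρ ^ k * L, by positivity, ?_⟩
  have hcont2 : ContinuousAt (iteratedDeriv 2 (cgf X P)) 0 := by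
    rw [iteratedDeriv_succ, iteratedDeriv_one]
    exact (analyticAt_cgf h0).deriv.deriv.continuousAt
  have hv : ∀ᶠ s in 𝓝 (0 : ℝ), 1 / 2 < iteratedDeriv 2 (cgf X P) s :=
    hcont2.tendsto.eventually_const_lt (by rw [hvar]; norm_num)
  filter_upwards [hCs, eventually_norm_complexMGF_sub_le hX h0 (by linarith : 0 < (1 - ρ₀) / 2),
    hL, hv, eventually_mem_interior_integrableExpSet h0] with s hCs hsub hLs hvs hs n hkn
  have hn : 1 ≤ n := hk.trans hkn
  have hn0 : (0 : ℝ) < n := by exact_mod_cast hn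
  have hM1 : 1 ≤ mgf X P s :=
    one_le_mgf hint hmean (integrable_of_mem_integrableExpSet (interior_subset hs))
  have hM0 : 0 < mgf X P s := by linarith
  set r : ℝ → ℝ := fun t => ‖complexMGF X P (s + t * Complex.I)‖ / mgf X P s with hr
  have hrpow : ∀ j t, r t ^ j
      = ‖complexMGF X P (s + t * Complex.I)‖ ^ j / mgf X P s ^ j := fun j t => div_pow _ _ _
  have hrk : Integrable fun t => r t ^ k := by
    simp_rw [hrpow]; exact hLs.1.div_const _
  have hrkL : ∫ t, r t ^ k ≤ L := by
    refine le_trans (integral_mono hrk hLs.1 fun t => ?_) hLs.2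
    rw [hrpow]
    exact div_le_self (by positivity) (one_le_pow₀ hM1)
  have hmain := integral_pow_le_of_gaussian_bound (r := r) (fun t => by positivity)
    ((continuous_complexMGF_vertical hs).norm.div_const _) hC hε hvs.le
    (fun t _ => by rw [hr]; simp only; rw [div_le_iff₀' hM0]; exact hCs t) hρpos
    (fun t ht => by
      have h1 := hρ₀t t ht
      have h2 := hsub t
      have h3 := norm_le_norm_add_norm_sub (complexMGF X P (t * Complex.I))
        (complexMGF X P (s + t * Complex.I))
      rw [norm_sub_rev] at h3
      have h4 : ‖complexMGF X P (s + t * Complex.I)‖ ≤ ρ :=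
        le_trans (by linarith) (le_max_left _ _)
      exact (div_le_self (norm_nonneg _) hM1).trans h4) hrk hrkL hn hkn
  have hfac : ∀ t : ℝ, ‖complexMGF X P (s + t * Complex.I)‖ ^ n = mgf X P s ^ n * r t ^ n :=
    fun t => by rw [hrpow, mul_div_cancel₀ _ (by positivity)]
  simp_rw [hfac]
  refine ⟨hmain.1.const_mul _, ?_⟩
  rw [integral_const_mul]
  refine mul_le_mul_of_nonneg_left (hmain.2.trans ?_) (by positivity)
  rw [add_assoc]
  refine add_le_add_right ?_ _
  have hsq : √(n : ℝ) ≤ n := by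
    rw [Real.sqrt_le_left hn0.le]
    have : (1 : ℝ) ≤ n := by exact_mod_cast hn
    nlinarith
  have hsq0 : 0 < √(n : ℝ) := Real.sqrt_pos.2 hn0
  have e1 : 512 * C / n * √(16 * Real.pi / n) = 512 * C * √(16 * Real.pi) / (n * √(n : ℝ)) := by
    rw [Real.sqrt_div (by positivity)]; field_simp
  have e2 : ρ ^ (n - k) * L ≤ D / ρ ^ k * L / (n * √(n : ℝ)) := by
    have h1 : ρ ^ (n - k) = ρ ^ n / ρ ^ k := by
      rw [eq_div_iff (by positivity), ← pow_add, Nat.sub_add_cancel hkn]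
    have h2 : ρ ^ n ≤ D / (n * √(n : ℝ)) := by
      rw [le_div_iff₀ (by positivity)]
      refine le_trans ?_ (hD n)
      calc ρ ^ n * (n * √(n : ℝ)) ≤ ρ ^ n * (n * n) := by gcongr
        _ = _ := by ring
    rw [h1]
    calc ρ ^ n / ρ ^ k * L ≤ D / (n * √(n : ℝ)) / ρ ^ k * L := by gcongr
      _ = _ := by field_simp
  rw [e1, add_div]
  gcongr

end

/-! ### Taylor expansions at the origin -/

lemma isBigO_sub_taylor {f : ℝ → ℝ} (hf : AnalyticAt ℝ f 0) (N : ℕ) :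
    (fun s => f s - ∑ k ∈ Finset.range N, iteratedDeriv k f 0 / k.factorial * s ^ k)
      =O[𝓝 0] fun s => |s| ^ N := by
  have h := hf.hasFPowerSeriesAt.isBigO_sub_partialSum_pow N
  simpa [FormalMultilinearSeries.partialSum, FormalMultilinearSeries.ofScalars, mul_comm]
    using h

lemma exists_eventually_abs_sub_taylor_le {f : ℝ → ℝ} (hf : AnalyticAt ℝ f 0) (N : ℕ) :
    ∃ C : ℝ, 0 < C ∧ ∀ᶠ s in 𝓝 0,
      |f s - ∑ k ∈ Finset.range N, iteratedDeriv k f 0 / k.factorial * s ^ k| ≤ C * |s| ^ N := by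
  obtain ⟨C, hC, h⟩ := (isBigO_sub_taylor hf N).exists_pos
  refine ⟨C, hC, h.bound.mono fun s hs => ?_⟩
  simpa using hs

section Expansion

variable {K : ℝ → ℝ} {m : ℕ}

lemma exists_eventually_abs_cgf_sub_le (hK : AnalyticAt ℝ K 0) (hK0 : K 0 = 0)
    (hK1 : deriv K 0 = 0) (hK2 : iteratedDeriv 2 K 0 = 1) (hm : 3 ≤ m)
    (hzero : ∀ k, 3 ≤ k → k < m → iteratedDeriv k K 0 = 0) :
    ∃ C : ℝ, 0 < C ∧ ∀ᶠ s in 𝓝 0,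
      |K s - (s ^ 2 / 2 + iteratedDeriv m K 0 / m.factorial * s ^ m)| ≤ C * |s| ^ (m + 1) := by
  obtain ⟨C, hC, h⟩ := exists_eventually_abs_sub_taylor_le hK (m + 1)
  refine ⟨C, hC, h.mono fun s hs => ?_⟩
  rw [Finset.sum_range_succ, Finset.sum_eq_single 2] at hs
  · convert hs using 4
    rw [hK2]; norm_num; ring
  · intro k hk hk2
    have hkm := Finset.mem_range.1 hk
    rcases lt_or_ge k 3 with h3 | h3
    · interval_cases k
      · simp [hK0]
      · simp [iteratedDeriv_one, hK1]
      · exact absurd rfl hk2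
    · rw [hzero k h3 hkm]; simp
  · intro h2
    exact absurd (Finset.mem_range.2 (by omega)) h2

lemma exists_eventually_abs_deriv_cgf_sub_le (hK : AnalyticAt ℝ K 0)
    (hK1 : deriv K 0 = 0) (hK2 : iteratedDeriv 2 K 0 = 1) (hm : 3 ≤ m)
    (hzero : ∀ k, 3 ≤ k → k < m → iteratedDeriv k K 0 = 0) :
    ∃ C : ℝ, 0 < C ∧ ∀ᶠ s in 𝓝 0, |deriv K s - s| ≤ C * |s| ^ (m - 1) := by
  -- The `k`-th derivative of `K'` is the `(k + 1)`-st of `K`, so stopping before `m - 1` only meets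
  -- orders below `m`.
  obtain ⟨C, hC, h⟩ := exists_eventually_abs_sub_taylor_le hK.deriv (m - 1)
  refine ⟨C, hC, h.mono fun s hs => ?_⟩
  simp only [← iteratedDeriv_succ'] at hs
  rw [Finset.sum_eq_single 1] at hs
  · simpa [hK2] using hs
  · intro k hk hk1
    have hkm := Finset.mem_range.1 hk
    rcases lt_or_ge k 2 with h3 | h3
    · interval_cases k
      · simp [iteratedDeriv_one, hK1]
      · exact absurd rfl hk1
    · rw [hzero (k + 1) (by omega) (by omega)]; simp
  · intro h2
    exact absurd (Finset.mem_range.2 (by omega)) h2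

lemma exists_eventually_abs_iteratedDeriv_two_cgf_sub_le (hK : AnalyticAt ℝ K 0)
    (hK2 : iteratedDeriv 2 K 0 = 1) (hm : 3 ≤ m)
    (hzero : ∀ k, 3 ≤ k → k < m → iteratedDeriv k K 0 = 0) :
    ∃ C : ℝ, 0 < C ∧ ∀ᶠ s in 𝓝 0, |iteratedDeriv 2 K s - 1| ≤ C * |s| ^ (m - 2) := by
  obtain ⟨C, hC, h⟩ := exists_eventually_abs_sub_taylor_le hK.deriv.deriv (m - 2)
  have e2 : deriv (deriv K) = iteratedDeriv 2 K := by
    rw [iteratedDeriv_succ, iteratedDeriv_one]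
  refine ⟨C, hC, h.mono fun s hs => ?_⟩
  simp only [← iteratedDeriv_succ'] at hs
  rw [Finset.sum_eq_single 0, e2] at hs
  · simpa [hK2] using hs
  · intro k hk hk0
    have hkm := Finset.mem_range.1 hk
    rw [hzero (k + 1 + 1) (by omega) (by omega)]; simp
  · intro h2
    exact absurd (Finset.mem_range.2 (by omega)) h2

/-- The Legendre transform of `K` at `K' s` exceeds its Gaussian counterpart by a multiple of
`s ^ m` when the first nonzero higher derivative of `K` at `0` is negative and of even order. -/
lemma exists_eventually_legendre_ge (hK : AnalyticAt ℝ K 0) (hK0 : K 0 = 0)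
    (hK1 : deriv K 0 = 0) (hK2 : iteratedDeriv 2 K 0 = 1) (hm : 3 ≤ m) (hmeven : Even m)
    (hzero : ∀ k, 3 ≤ k → k < m → iteratedDeriv k K 0 = 0) (hneg : iteratedDeriv m K 0 < 0) :
    ∃ c : ℝ, 0 < c ∧ ∀ᶠ s in 𝓝 0, c * s ^ m ≤ s * deriv K s - K s - deriv K s ^ 2 / 2 := by
  obtain ⟨C₁, hC₁, h₁⟩ := exists_eventually_abs_cgf_sub_le hK hK0 hK1 hK2 hm hzero
  obtain ⟨C₂, hC₂, h₂⟩ := exists_eventually_abs_deriv_cgf_sub_le hK hK1 hK2 hm hzero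
  set g := -(iteratedDeriv m K 0 / m.factorial) with hg
  have hg0 : 0 < g := by
    rw [hg, neg_pos]; exact div_neg_of_neg_of_pos hneg (by positivity)
  -- On this neighbourhood the remainders of order `m + 1` use up at most half of the leading term
  -- `g * s ^ m`.
  have h3 : ∀ᶠ s : ℝ in 𝓝 0, |s| < min 1 (g / 2 / (C₁ + C₂ ^ 2)) := by
    have : Tendsto (fun s : ℝ => |s|) (𝓝 0) (𝓝 0) := by
      simpa using (continuous_abs (G := ℝ)).tendsto 0
    exact this.eventually_lt_const (by positivity)
  refine ⟨g / 2, by positivity, ?_⟩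
  filter_upwards [h₁, h₂, h3] with s hs1 hs2 hs3
  have hs1' : |s| ≤ 1 := (hs3.trans_le (min_le_left _ _)).le
  have hsC : |s| * (C₁ + C₂ ^ 2) ≤ g / 2 := by
    rw [← le_div_iff₀ (by positivity)]; exact (hs3.trans_le (min_le_right _ _)).le
  -- Since `s K' - K'^2 / 2 = s^2 / 2 - (K' - s)^2 / 2`, the error of `K'` enters only squared, and
  -- `2 (m - 1) ≥ m + 1`.
  have hsq : (deriv K s - s) ^ 2 ≤ C₂ ^ 2 * |s| ^ (m + 1) := by
    calc (deriv K s - s) ^ 2 = |deriv K s - s| ^ 2 := (sq_abs _).symm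
      _ ≤ (C₂ * |s| ^ (m - 1)) ^ 2 := by gcongr
      _ = C₂ ^ 2 * |s| ^ ((m - 1) * 2) := by rw [mul_pow, ← pow_mul]
      _ ≤ C₂ ^ 2 * |s| ^ (m + 1) := by
        gcongr ?_ * ?_
        exact pow_le_pow_of_le_one (abs_nonneg s) hs1' (by omega)
  have hpow : |s| ^ (m + 1) = |s| * s ^ m := by
    rw [pow_succ, hmeven.pow_abs, mul_comm]
  have hsm : 0 ≤ s ^ m := hmeven.pow_nonneg s
  have h4 := (abs_le.1 hs1).2
  have h5 : (|s| * (C₁ + C₂ ^ 2)) * s ^ m ≤ g / 2 * s ^ m := by gcongr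
  have h6 : iteratedDeriv m K 0 / m.factorial = -g := by rw [hg]; ring
  rw [h6] at h4
  rw [hpow] at hsq h4
  have h7 : 0 ≤ C₂ ^ 2 * (|s| * s ^ m) := by positivity
  nlinarith

end Expansion

/-! ### Elementary inequalities for the correction factors -/

lemma sqrt_div_le_mul_one_add {a v y : ℝ} (ha : 0 ≤ a) (hy : 0 ≤ y) (hv : 1 / 2 ≤ v)
    (hvy : 1 - y ≤ v) : √(a / v) ≤ √a * (1 + 2 * y) := by
  have hv0 : 0 < v := by linarith
  rw [← Real.sqrt_sq (by positivity : 0 ≤ 1 + 2 * y), ← Real.sqrt_mul ha]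
  refine Real.sqrt_le_sqrt ?_
  rw [div_le_iff₀ hv0, mul_assoc]
  refine le_mul_of_one_le_right ha ?_
  nlinarith [mul_nonneg hy (by linarith : 0 ≤ v - 1 / 2), mul_nonneg (mul_nonneg hy hy) hv0.le]

/-- If `D s^{m-2} ≤ c n s^m`, then `1 + u ≤ exp u` makes the product at most `1`. Otherwise `c n s^2
≤ D`, and `s^{m-2} ≤ s^2` because `m ≥ 4` and `|s| ≤ 1`. -/
lemma exp_neg_mul_one_add_le {c D s : ℝ} {m n : ℕ} (hc : 0 < c) (hD : 0 ≤ D) (hs : |s| ≤ 1)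
    (hm : 4 ≤ m) (hmeven : Even m) (hn : 1 ≤ n) :
    Real.exp (-(c * n * s ^ m)) * (1 + D * s ^ (m - 2)) ≤ 1 + D ^ 2 / c / n := by
  have hn0 : (0 : ℝ) < n := by exact_mod_cast hn
  have hm2 : Even (m - 2) := hmeven.tsub even_two
  have hy : 0 ≤ s ^ (m - 2) := hm2.pow_nonneg s
  have hsm : s ^ m = s ^ (m - 2) * s ^ 2 := by rw [← pow_add]; congr 1; omega
  rcases le_or_gt (D * s ^ (m - 2)) (c * n * s ^ m) with h | h
  · calc Real.exp (-(c * n * s ^ m)) * (1 + D * s ^ (m - 2))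
        ≤ Real.exp (-(c * n * s ^ m)) * Real.exp (c * n * s ^ m) := by
          gcongr
          linarith [Real.add_one_le_exp (c * n * s ^ m)]
      _ = 1 := by rw [← Real.exp_add]; simp
      _ ≤ _ := by
        have : 0 ≤ D ^ 2 / c / n := by positivity
        linarith
  · have hpos : 0 < s ^ (m - 2) := by
      refine lt_of_le_of_ne hy fun h0 => ?_
      rw [hsm, ← h0] at h
      simp at h
    have h1 : c * n * s ^ 2 ≤ D := by
      rw [hsm] at h
      have : (c * n * s ^ 2) * s ^ (m - 2) < D * s ^ (m - 2) := by linarith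
      exact (lt_of_mul_lt_mul_right this hy).le
    have h2 : s ^ (m - 2) ≤ s ^ 2 := by
      rw [← hm2.pow_abs s, ← sq_abs s]
      exact pow_le_pow_of_le_one (abs_nonneg s) hs (by omega)
    have h3 : D * s ^ (m - 2) ≤ D ^ 2 / c / n := by
      rw [div_div, le_div_iff₀ (by positivity)]
      calc D * s ^ (m - 2) * (c * n) ≤ D * s ^ 2 * (c * n) := by gcongr
        _ = D * (c * n * s ^ 2) := by ring
        _ ≤ D * D := by gcongr
        _ = D ^ 2 := by ring
    have h4 : Real.exp (-(c * n * s ^ m)) ≤ 1 := by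
      rw [Real.exp_le_one_iff, neg_nonpos]
      have := hmeven.pow_nonneg s
      positivity
    calc Real.exp (-(c * n * s ^ m)) * (1 + D * s ^ (m - 2)) ≤ 1 * (1 + D * s ^ (m - 2)) := by
          gcongr
      _ ≤ _ := by linarith

/-! ### The local limit theorem for densities of normalized sums -/

section Main

variable {Ω Ω' : Type*} [MeasurableSpace Ω] [MeasurableSpace Ω'] {P : Measure Ω}
  {P' : Measure Ω'} {X : Ω → ℝ} {ξ : ℕ → Ω' → ℝ}

lemma complexMGF_normalizedSum_vertical (hindep : iIndepFun ξ P')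
    (hident : ∀ i, IdentDistrib (ξ i) X P' P) {n : ℕ} (hn : 1 ≤ n) (s w : ℝ) :
    complexMGF (normalizedSum ξ n) P'
        ((s * √(n : ℝ) : ℝ) + (-2 * Real.pi * w : ℝ) * Complex.I)
      = complexMGF X P (s + ((-2 * Real.pi / √(n : ℝ)) * w : ℝ) * Complex.I) ^ n := by
  have hn0 : (0 : ℝ) < n := by exact_mod_cast hn
  have hsq : ((√(n : ℝ) : ℝ) : ℂ) ≠ 0 := by
    exact_mod_cast (Real.sqrt_pos.2 hn0).ne'
  rw [complexMGF_normalizedSum hindep hident]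
  congr 2
  push_cast
  field_simp

/-- Riemann–Lebesgue for the density of the normalized sum gives decay of the `n`-th power, and an
`n`-th root gives the decay for `X`. -/
lemma tendsto_complexMGF_cocompact (hindep : iIndepFun ξ P')
    (hident : ∀ i, IdentDistrib (ξ i) X P' P) {n : ℕ} (hn : 1 ≤ n) {p : ℝ → ℝ}
    (hp : IsDensity p (normalizedSum ξ n) P') :
    Tendsto (fun t : ℝ => complexMGF X P (t * Complex.I)) (cocompact ℝ) (𝓝 0) := by
  have hn0 : (0 : ℝ) < n := by exact_mod_cast hn
  have hc : (-2 * Real.pi / √(n : ℝ)) ≠ 0 :=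
    div_ne_zero (by simp [Real.pi_ne_zero]) (Real.sqrt_pos.2 hn0).ne'
  have h1 := Real.zero_at_infty_fourier (expTilt p 0)
  have h2 : 𝓕 (expTilt p 0) = fun w : ℝ =>
      complexMGF X P (((-2 * Real.pi / √(n : ℝ)) * w : ℝ) * Complex.I) ^ n := by
    funext w
    rw [hp.fourier_expTilt]
    have := complexMGF_normalizedSum_vertical hindep hident hn 0 w
    simpa using this
  rw [h2] at h1
  have h3 := h1.comp (Homeomorph.mulLeft₀ _ (inv_ne_zero hc)).isClosedEmbedding.tendsto_cocompact
  have h4 : Tendsto (fun t : ℝ => ‖complexMGF X P (t * Complex.I)‖ ^ n) (cocompact ℝ) (𝓝 0) := by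
    have := h3.norm
    rw [norm_zero] at this
    refine this.congr fun t => ?_
    simp only [Function.comp, Homeomorph.coe_mulLeft₀, norm_pow]
    rw [mul_inv_cancel_left₀ hc]
  rw [tendsto_zero_iff_norm_tendsto_zero]
  have h5 := h4.rpow_const (p := 1 / (n : ℝ)) (Or.inr (by positivity))
  rw [Real.zero_rpow (by positivity)] at h5
  refine h5.congr fun t => ?_
  rw [one_div, Real.pow_rpow_inv_natCast (norm_nonneg _) (by omega)]

/-- Plancherel for the tilted bounded density makes the `n`-th power of the transform square
integrable; hence the exponent `2 * n` and the threshold `2 * n₀` of the theorem. -/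
lemma exists_eventually_integral_norm_complexMGF_pow_le [IsProbabilityMeasure P]
    (h0 : 0 ∈ interior (integrableExpSet X P)) (hindep : iIndepFun ξ P')
    (hident : ∀ i, IdentDistrib (ξ i) X P' P) {n : ℕ} (hn : 1 ≤ n) {p : ℝ → ℝ}
    (hp : IsDensity p (normalizedSum ξ n) P') {B : ℝ} (hB : ∀ y, p y ≤ B) :
    ∃ L : ℝ, ∀ᶠ s : ℝ in 𝓝 0,
      Integrable (fun t : ℝ => ‖complexMGF X P (s + t * Complex.I)‖ ^ (2 * n)) ∧
      ∫ t : ℝ, ‖complexMGF X P (s + t * Complex.I)‖ ^ (2 * n) ≤ L := by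
  have hn0 : (0 : ℝ) < n := by exact_mod_cast hn
  have hsq : √(n : ℝ) ≠ 0 := (Real.sqrt_pos.2 hn0).ne'
  set a : ℝ := -2 * Real.pi / √(n : ℝ) with ha
  have ha0 : a ≠ 0 := div_ne_zero (by simp [Real.pi_ne_zero]) hsq
  have hB0 : 0 ≤ B := (hp.nonneg 0).trans (hB 0)
  have htwo : Tendsto (fun s : ℝ => 2 * s) (𝓝 0) (𝓝 0) := by
    simpa using (continuous_const_mul (2 : ℝ)).tendsto 0
  have hM : ∀ᶠ s : ℝ in 𝓝 0, mgf X P (2 * s) < 2 := by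
    have h1 : Tendsto (mgf X P) (𝓝 0) (𝓝 1) := by
      simpa using (analyticAt_mgf h0).continuousAt.tendsto
    exact (h1.comp htwo).eventually_lt_const (by norm_num)
  -- `|a|` is the Jacobian of `t = a w`, and `2 ^ n` dominates `M(2s)^n` for `s` near `0`.
  refine ⟨|a| * (B * 2 ^ n), ?_⟩
  filter_upwards [hM, eventually_mem_interior_integrableExpSet h0,
    htwo.eventually (eventually_mem_interior_integrableExpSet h0)] with s hs hs1 hs2
  have i1 : Integrable (fun ω => Real.exp (s * √(n : ℝ) * normalizedSum ξ n ω)) P' := by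
    refine integrable_exp_mul_normalizedSum hindep hident n ?_
    rw [mul_div_cancel_right₀ _ hsq]
    exact integrable_of_mem_integrableExpSet (interior_subset hs1)
  have i2 : Integrable (fun ω => Real.exp (2 * (s * √(n : ℝ)) * normalizedSum ξ n ω)) P' := by
    refine integrable_exp_mul_normalizedSum hindep hident n ?_
    rw [← mul_assoc, mul_div_cancel_right₀ _ hsq]
    exact integrable_of_mem_integrableExpSet (interior_subset hs2)
  have hmain := hp.integral_norm_complexMGF_sq_le hB i1 i2
  simp only [complexMGF_normalizedSum_vertical hindep hident hn, norm_pow, ← pow_mul] at hmain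
  rw [mul_comm n 2] at hmain
  have hmgf : mgf (normalizedSum ξ n) P' (2 * (s * √(n : ℝ))) = mgf X P (2 * s) ^ n := by
    have h1 := complexMGF_normalizedSum hindep hident n ((2 * (s * √(n : ℝ)) : ℝ) : ℂ)
    rw [← Complex.ofReal_div, complexMGF_ofReal, complexMGF_ofReal, ← mul_assoc,
      mul_div_cancel_right₀ _ hsq] at h1
    rw [← mul_assoc]
    exact_mod_cast h1
  set g : ℝ → ℝ := fun t => ‖complexMGF X P (s + t * Complex.I)‖ ^ (2 * n) with hg
  have hI : Integrable fun w => g (a * w) := hmain.1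
  have hle : ∫ w, g (a * w) ≤ B * mgf (normalizedSum ξ n) P' (2 * (s * √(n : ℝ))) := hmain.2
  refine ⟨(integrable_comp_mul_left_iff g ha0).1 hI, ?_⟩
  rw [Measure.integral_comp_mul_left, smul_eq_mul, abs_inv, hmgf] at hle
  rw [inv_mul_le_iff₀ (abs_pos.2 ha0)] at hle
  refine hle.trans ?_
  gcongr
  exact mgf_nonneg

lemma IsDensity.mul_exp_le_of_integral_bound [IsProbabilityMeasure P]
    (hindep : iIndepFun ξ P') (hident : ∀ i, IdentDistrib (ξ i) X P' P) {n : ℕ} (hn : 1 ≤ n)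
    {p : ℝ → ℝ} (hc : Continuous p) (hp : IsDensity p (normalizedSum ξ n) P') {s : ℝ}
    (hs : s ∈ interior (integrableExpSet X P))
    (hint : Integrable fun t : ℝ => ‖complexMGF X P (s + t * Complex.I)‖ ^ n) (x : ℝ) :
    p x * Real.exp (s * √(n : ℝ) * x)
      ≤ √(n : ℝ) / (2 * Real.pi) * ∫ t : ℝ, ‖complexMGF X P (s + t * Complex.I)‖ ^ n := by
  have hn0 : (0 : ℝ) < n := by exact_mod_cast hn
  have hsq0 : 0 < √(n : ℝ) := Real.sqrt_pos.2 hn0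
  have hsq : √(n : ℝ) ≠ 0 := hsq0.ne'
  set a : ℝ := -2 * Real.pi / √(n : ℝ) with ha
  have ha0 : a ≠ 0 := div_ne_zero (by simp [Real.pi_ne_zero]) hsq
  have i1 : Integrable (fun ω => Real.exp (s * √(n : ℝ) * normalizedSum ξ n ω)) P' := by
    refine integrable_exp_mul_normalizedSum hindep hident n ?_
    rw [mul_div_cancel_right₀ _ hsq]
    exact integrable_of_mem_integrableExpSet (interior_subset hs)
  have hcont := (continuous_complexMGF_vertical hs).pow n
  have hI : Integrable fun t : ℝ => complexMGF X P (s + t * Complex.I) ^ n := by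
    refine (integrable_norm_iff hcont.aestronglyMeasurable).1 ?_
    simpa only [Pi.pow_apply, norm_pow] using hint
  have hmain := hp.mul_exp_le_integral hc i1 (by
    simp only [complexMGF_normalizedSum_vertical hindep hident hn]
    exact hI.comp_mul_left' ha0) x
  simp only [complexMGF_normalizedSum_vertical hindep hident hn, norm_pow] at hmain
  refine hmain.trans_eq ?_
  rw [Measure.integral_comp_mul_left
    (fun t : ℝ => ‖complexMGF X P (s + t * Complex.I)‖ ^ n) a, smul_eq_mul]
  congr 1
  rw [ha, abs_inv, abs_div, abs_of_pos hsq0, inv_div, neg_mul, abs_neg,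
    abs_of_pos (by positivity)]

/-- Absolute continuity is inherited from index `k`, while integrability of the characteristic
function is supplied at index `n`. -/
lemma exists_continuous_isDensity_normalizedSum [IsProbabilityMeasure P]
    (h0 : 0 ∈ interior (integrableExpSet X P)) (hindep : iIndepFun ξ P')
    (hident : ∀ i, IdentDistrib (ξ i) X P' P) {k n : ℕ} (hk : 1 ≤ k) (hkn : k ≤ n) {p : ℝ → ℝ}
    (hp : IsDensity p (normalizedSum ξ k) P')
    (hint : Integrable fun t : ℝ => ‖complexMGF X P (t * Complex.I)‖ ^ n) :
    ∃ q : ℝ → ℝ, Continuous q ∧ IsBoundedAbove q ∧ IsDensity q (normalizedSum ξ n) P' := by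
  have := hindep.isProbabilityMeasure
  have hn : 1 ≤ n := hk.trans hkn
  have hn0 : (0 : ℝ) < n := by exact_mod_cast hn
  have ha0 : -2 * Real.pi / √(n : ℝ) ≠ 0 :=
    div_ne_zero (by simp [Real.pi_ne_zero]) (Real.sqrt_pos.2 hn0).ne'
  refine exists_continuous_isDensity (aemeasurable_normalizedSum hident n)
    (map_normalizedSum_absolutelyContinuous hindep hident hk hkn ?_) ?_
  · rw [hp.hasLaw.map_eq]
    exact withDensity_absolutelyContinuous _ _
  · have hcont : Continuous fun t : ℝ => complexMGF X P (t * Complex.I) := by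
      simpa using continuous_complexMGF_vertical h0
    have hI : Integrable fun t : ℝ => complexMGF X P (t * Complex.I) ^ n := by
      refine (integrable_norm_iff (hcont.pow n).aestronglyMeasurable).1 ?_
      simpa only [Pi.pow_apply, norm_pow] using hint
    have h1 := hI.comp_mul_left' ha0
    refine h1.congr (ae_of_all _ fun w => ?_)
    have := complexMGF_normalizedSum_vertical hindep hident hn 0 w
    simpa using this.symm

/-- Ratio of a density to the Gaussian density at `x = √n K'(s)`, where `K` is the log-Laplace
transform. -/
lemma div_gaussianPDFReal_le {p n s μ k v y A x : ℝ} (hn : 1 ≤ n) (hx : x = √n * μ) (hy : 0 ≤ y)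
    (hv : 1 / 2 ≤ v) (hvy : 1 - y ≤ v) (hA : 0 ≤ A)
    (h : p * Real.exp (s * √n * x) ≤ √n / (2 * Real.pi) *
      (Real.exp (n * k) * (√(2 * Real.pi / (n * v)) + A / (n * √n)))) :
    p / gaussianPDFReal 0 1 x
      ≤ Real.exp (-(n * (s * μ - k - μ ^ 2 / 2))) * (1 + 2 * y + A / n) := by
  have hn0 : 0 < n := by linarith
  have hsq0 : 0 < √n := Real.sqrt_pos.2 hn0
  have hsqn : √n ^ 2 = n := Real.sq_sqrt hn0.le
  have hpi : 0 < √(2 * Real.pi) := by positivity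
  have hpi2 : √(2 * Real.pi) ^ 2 = 2 * Real.pi := Real.sq_sqrt (by positivity)
  have hpi1 : 1 ≤ √(2 * Real.pi) := by
    rw [Real.one_le_sqrt]; linarith [Real.pi_gt_three]
  have h1 : √(2 * Real.pi / (n * v)) ≤ √(2 * Real.pi) / √n * (1 + 2 * y) := by
    rw [← div_div, ← Real.sqrt_div (by positivity)]
    exact sqrt_div_le_mul_one_add (by positivity) hy hv hvy
  have hG : gaussianPDFReal 0 1 x = (√(2 * Real.pi))⁻¹ * Real.exp (-x ^ 2 / 2) := by
    simp [gaussianPDFReal]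
  have hdist : ∀ q : ℝ, 0 < q → √n / q ^ 2 * (q / √n * (1 + 2 * y) + A / (n * √n))
      = q⁻¹ * (1 + 2 * y) + (q ^ 2)⁻¹ * (A / n) := fun q hq => by field_simp
  have h2 : √n / (2 * Real.pi) * (√(2 * Real.pi / (n * v)) + A / (n * √n))
      ≤ (√(2 * Real.pi))⁻¹ * (1 + 2 * y + A / n) := by
    calc √n / (2 * Real.pi) * (√(2 * Real.pi / (n * v)) + A / (n * √n))
        ≤ √n / (2 * Real.pi) * (√(2 * Real.pi) / √n * (1 + 2 * y) + A / (n * √n)) := by gcongr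
      _ = (√(2 * Real.pi))⁻¹ * (1 + 2 * y) + (√(2 * Real.pi) ^ 2)⁻¹ * (A / n) := by
        have := hdist _ hpi
        rwa [hpi2] at this ⊢
      _ ≤ (√(2 * Real.pi))⁻¹ * (1 + 2 * y) + (√(2 * Real.pi))⁻¹ * (A / n) := by
        gcongr
        exact le_self_pow₀ hpi1 (by norm_num)
      _ = _ := by ring
  have h3 : p ≤ Real.exp (n * k) * Real.exp (-(s * √n * x)) *
      ((√(2 * Real.pi))⁻¹ * (1 + 2 * y + A / n)) := by
    have h4 : p = p * Real.exp (s * √n * x) * Real.exp (-(s * √n * x)) := by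
      rw [mul_assoc, ← Real.exp_add]; simp
    rw [h4]
    calc _ ≤ √n / (2 * Real.pi) * (Real.exp (n * k) * (√(2 * Real.pi / (n * v))
          + A / (n * √n))) * Real.exp (-(s * √n * x)) := by gcongr
      _ = Real.exp (n * k) * Real.exp (-(s * √n * x)) *
          (√n / (2 * Real.pi) * (√(2 * Real.pi / (n * v)) + A / (n * √n))) := by ring
      _ ≤ _ := by gcongr
  rw [hG, div_le_iff₀ (by positivity)]
  refine h3.trans_eq ?_
  -- At `x = √n μ` one has `s √n x = n s μ` and `x^2 / 2 = n μ^2 / 2`, so the tilt and the Gaussian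
  -- combine into the Legendre gap.
  have e : Real.exp (n * k) * Real.exp (-(s * √n * x))
      = Real.exp (-(n * (s * μ - k - μ ^ 2 / 2))) * Real.exp (-x ^ 2 / 2) := by
    rw [← Real.exp_add, ← Real.exp_add]
    congr 1
    have e1 : √n * (√n * μ) = n * μ := by rw [← mul_assoc, ← sq, hsqn]
    rw [hx, mul_assoc s, e1, mul_pow, hsqn]
    ring
  rw [e]; ring

end Main

/-! ### The main theorem -/

/-- A strictly differentiable map with nonzero derivative sends neighbourhoods to neighbourhoods.
Applied to `K'`, it solves the saddle point equation inside any prescribed neighbourhood of `0`. -/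
lemma exists_forall_abs_le_exists_eq {f : ℝ → ℝ} (hf : AnalyticAt ℝ f 0) (h0 : f 0 = 0)
    (h1 : deriv f 0 ≠ 0) {S : Set ℝ} (hS : S ∈ 𝓝 0) :
    ∃ τ : ℝ, 0 < τ ∧ ∀ y, |y| ≤ τ → ∃ s ∈ S, f s = y := by
  have hd : HasStrictDerivAt f (deriv f 0) 0 := hf.hasStrictDerivAt
  have hmap := hd.map_nhds_eq h1
  rw [h0] at hmap
  have him : f '' S ∈ 𝓝 0 := hmap ▸ image_mem_map hS
  obtain ⟨τ, hτ, hsub⟩ := Metric.nhds_basis_closedBall.mem_iff.1 him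
  exact ⟨τ, hτ, fun y hy => hsub (by simpa using hy)⟩

end LocalLimit

end

open Filter Topology LocalLimit

theorem corollary1p3
    {Ω Ω' : Type*} [MeasurableSpace Ω] [MeasurableSpace Ω']
    (P : Measure Ω) [IsProbabilityMeasure P] (P' : Measure Ω') [IsProbabilityMeasure P']
    -- a random variable `X` and a sequence `ξ` of independent copies of it
    (X : Ω → ℝ) (ξ : ℕ → Ω' → ℝ)
    (hindep : iIndepFun ξ P') (hident : ∀ i, IdentDistrib (ξ i) X P' P)
    (hmean : ∫ ω, X ω ∂P = 0) (hvar : variance X P = 1)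
    -- for `n = n₀` the normalized sum has a bounded density
    (n₀ : ℕ) (hn₀ : 1 ≤ n₀)
    (hbdd : ∃ p : ℝ → ℝ, LocalLimit.IsDensity p (LocalLimit.normalizedSum ξ n₀) P' ∧
      LocalLimit.IsBoundedAbove p)
    -- `X` has a finite exponential moment
    (hexp : ∃ b : ℝ, 0 < b ∧ Integrable (fun ω => Real.exp (b * |X ω|)) P)
    -- `γ_m` is the first nonzero cumulant of order at least `3`, `m` is even and `γ_m < 0`
    (m : ℕ) (hm4 : 4 ≤ m) (hmeven : Even m)
    (hzero : ∀ k, 3 ≤ k → k < m → LocalLimit.cumulant X P k = 0)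
    (hneg : LocalLimit.cumulant X P m < 0) :
    ∃ τ₀ : ℝ, 0 < τ₀ ∧ ∃ c : ℝ, 0 < c ∧ ∀ n : ℕ, 2 * n₀ ≤ n →
      (∃ p : ℝ → ℝ, Continuous p ∧ LocalLimit.IsBoundedAbove p ∧
        LocalLimit.IsDensity p (LocalLimit.normalizedSum ξ n) P') ∧
      ∀ p : ℝ → ℝ, Continuous p → LocalLimit.IsDensity p (LocalLimit.normalizedSum ξ n) P' →
        ∀ x : ℝ, |x / √(n : ℝ)| ≤ τ₀ →
          (p x - gaussianPDFReal 0 1 x) / gaussianPDFReal 0 1 x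
            ≤ c * Real.log n ^ 3 / n := by
  obtain ⟨b, hb, hbI⟩ := hexp
  obtain ⟨p₀, hp₀, B, hB⟩ := hbdd
  have hX : AEMeasurable X P := (hident 0).aemeasurable_snd
  have h0 : 0 ∈ interior (integrableExpSet X P) := zero_mem_interior_integrableExpSet hX hb hbI
  have hXI : Integrable X P := by
    simpa using integrable_pow_of_mem_interior_integrableExpSet h0 1
  set K := cgf X P with hK
  have hKa : AnalyticAt ℝ K 0 := analyticAt_cgf h0
  have hK0 : K 0 = 0 := by simp [hK]
  have hK1 : deriv K 0 = 0 := by rw [hK, deriv_cgf_zero h0, hmean]; simp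
  have hK2 : iteratedDeriv 2 K 0 = 1 := by
    rw [hK, ← variance_tilted_mul h0, ← hvar]
    simp
  obtain ⟨L, hL⟩ := exists_eventually_integral_norm_complexMGF_pow_le h0 hindep hident hn₀ hp₀ hB
  obtain ⟨A, hA, hAs⟩ := exists_integral_norm_complexMGF_pow_le hX h0 hXI hmean hK2
    (tendsto_complexMGF_cocompact hindep hident hn₀ hp₀) (by omega : 1 ≤ 2 * n₀) hL
  obtain ⟨c, hc, hcs⟩ := exists_eventually_legendre_ge hKa hK0 hK1 hK2 (by omega) hmeven hzero hneg
  obtain ⟨D, hD, hDs⟩ :=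
    exists_eventually_abs_iteratedDeriv_two_cgf_sub_le hKa hK2 (by omega : 3 ≤ m) hzero
  have hcont2 : ContinuousAt (iteratedDeriv 2 K) 0 := by
    rw [iteratedDeriv_succ, iteratedDeriv_one]
    exact hKa.deriv.deriv.continuousAt
  have hv : ∀ᶠ s in 𝓝 (0 : ℝ), 1 / 2 < iteratedDeriv 2 K s :=
    hcont2.tendsto.eventually_const_lt (by rw [hK2]; norm_num)
  have hdd : deriv (deriv K) 0 = 1 := by rw [← hK2, iteratedDeriv_succ, iteratedDeriv_one]
  have hone : ∀ᶠ s : ℝ in 𝓝 0, |s| ≤ 1 := by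
    filter_upwards [Metric.closedBall_mem_nhds (0 : ℝ) one_pos] with s hs
    simpa using hs
  -- Every condition on `s` is placed in one neighbourhood that does not involve `n` or `x`, which
  -- makes `τ₀` uniform.
  have hall := hAs.and (hcs.and (hDs.and (hv.and (hone.and
    (eventually_mem_interior_integrableExpSet h0)))))
  obtain ⟨τ₀, hτ₀, hsol⟩ := exists_forall_abs_le_exists_eq hKa.deriv hK1
    (by rw [hdd]; norm_num) hall
  have hlog2 : 0 < Real.log 2 := Real.log_pos (by norm_num)
  set E := (2 * D) ^ 2 / c + A with hE
  have hE0 : 0 < E := by positivity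
  -- The estimate obtained is `E / n`; the logarithm costs only `log 2 ≤ log n`, valid because `n ≥
  -- 2 * n₀ ≥ 2`.
  refine ⟨τ₀, hτ₀, E / Real.log 2 ^ 3, by positivity, fun n hn => ⟨?_, ?_⟩⟩
  · refine exists_continuous_isDensity_normalizedSum h0 hindep hident hn₀ (by omega) hp₀ ?_
    -- Plain Fourier inversion is the untilted case `s = 0`.
    have := (hAs.self_of_nhds n hn).1
    simpa using this
  · intro p hpc hp x hx
    have hn1 : 1 ≤ n := by omega
    have hn2 : 2 ≤ n := by omega
    have hn0 : (0 : ℝ) < n := by exact_mod_cast hn1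
    have hsq0 : 0 < √(n : ℝ) := Real.sqrt_pos.2 hn0
    obtain ⟨s, ⟨hsA, hsc, hsD, hsv, hs1, hs⟩, hsx⟩ := hsol _ hx
    have hm2 : Even (m - 2) := hmeven.tsub even_two
    rw [hm2.pow_abs] at hsD
    have hy : 0 ≤ D * s ^ (m - 2) := mul_nonneg hD.le (hm2.pow_nonneg s)
    have hbound := (IsDensity.mul_exp_le_of_integral_bound hindep hident hn1 hpc hp hs
      (hsA n hn).1 x).trans (mul_le_mul_of_nonneg_left (hsA n hn).2 (by positivity))
    have hmgf : mgf X P s ^ n = Real.exp (n * K s) := by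
      rw [Real.exp_nat_mul, hK, exp_cgf (integrable_of_mem_integrableExpSet (interior_subset hs))]
    rw [hmgf] at hbound
    have hratio := div_gaussianPDFReal_le (n := n) (by exact_mod_cast hn1)
      (by rw [hsx]; field_simp : x = √(n : ℝ) * deriv K s) hy hsv.le
      (by linarith [(abs_le.1 hsD).1]) hA.le hbound
    have hexp1 : Real.exp (-(n * (s * deriv K s - K s - deriv K s ^ 2 / 2)))
        ≤ Real.exp (-(c * n * s ^ m)) := by
      rw [Real.exp_le_exp, neg_le_neg_iff]
      calc c * n * s ^ m = n * (c * s ^ m) := by ring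
        _ ≤ _ := by gcongr
    have hexp2 : Real.exp (-(c * n * s ^ m)) ≤ 1 := by
      rw [Real.exp_le_one_iff, neg_nonpos]
      have := hmeven.pow_nonneg s
      positivity
    have hfin : p x / gaussianPDFReal 0 1 x ≤ 1 + E / n := by
      calc p x / gaussianPDFReal 0 1 x
          ≤ Real.exp (-(c * n * s ^ m)) * (1 + 2 * (D * s ^ (m - 2)) + A / n) :=
            hratio.trans (by gcongr)
        _ = Real.exp (-(c * n * s ^ m)) * (1 + (2 * D) * s ^ (m - 2))
            + Real.exp (-(c * n * s ^ m)) * (A / n) := by ring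
        _ ≤ (1 + (2 * D) ^ 2 / c / n) + 1 * (A / n) := by
            gcongr
            exact exp_neg_mul_one_add_le hc (by positivity) hs1 hm4 hmeven hn1
        _ = 1 + E / n := by rw [hE]; ring
    have hG : gaussianPDFReal 0 1 x ≠ 0 := (gaussianPDFReal_pos 0 1 x (by norm_num)).ne'
    rw [sub_div, div_self hG]
    have hlog : Real.log 2 ≤ Real.log n := Real.log_le_log (by norm_num) (by exact_mod_cast hn2)
    have h3 : E ≤ E / Real.log 2 ^ 3 * Real.log n ^ 3 := by
      rw [div_mul_eq_mul_div, le_div_iff₀ (by positivity)]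
      gcongr
    calc p x / gaussianPDFReal 0 1 x - 1 ≤ E / n := by linarith
      _ ≤ _ := by gcongr
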